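/- Let $\mathcal X$ be a measurable space (for example a compact subset of $\mathbb R^{d}$) and $k:\mathcal X\times\mathcal X\to\mathbb R$ a jointly measurable positive semidefinite kernel with $k(x,x)\le 1$ for all $x$. Let $\mathcal H_k$ be its reproducing kernel Hilbert space (RKHS) and let $f\in\mathcal H_k$ with $\|f\|_k\le B$. Write $s(a)=(1+e^{-a})^{-1}$ and $\dot s(a)=s(a)(1-s(a))$, and fix $\lambda>0$ and $0<\delta<1$. At each round $t=1,2,\dots$ a pair $(x_t,x_t')\in\mathcal X\times\mathcal X$ is chosen, possibly depending on the past, and a label $y_t\in\{0,1\}$ is observed whose conditional probability of being $1$, given the past rounds and $(x_t,x_t')$, is $s(f(x_t)-f(x_t'))$. Put $\mathcal Z=\mathcal X\times\mathcal X$ and let $k^{\mathrm D}$ be the dueling kernel on $\mathcal Z$, $$k^{\mathrm D}\big((x_1,x_1'),(x_2,x_2')\big)=k(x_1,x_2)+k(x_1',x_2')-k(x_1,x_2')-k(x_1',x_2),$$ with RKHS $\mathcal H_{k^{\mathrm D}}$. Write $z_\tau=(x_\tau,x'_\tau)$, and let $h_t$ be the minimizer over $h\in\mathcal H_{k^{\mathrm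 D}}$ of $$\sum_{\tau=1}^t\Big(-y_\tau\log s(h(z_\tau))-(1-y_\tau)\log\big(1-s(h(z_\tau))\big)\Big)+\frac\lambda2\|h\|_{k^{\mathrm D}}^2 .$$ Let $R=B\sup_{z}\sqrt{k^{\mathrm D}(z,z)}\le 2B$, so that functions of norm at most $B$ in $\mathcal H_{k^{\mathrm D}}$ take values in $[-R,R]$, and put $\kappa=\sup_{|a|\le R}1/\dot s(a)$ and $L=\sup_{|a|\le R}\dot s(a)$. With $K^{\mathrm D}(w_1,\dots,w_t)=[k^{\mathrm D}(w_i,w_j)]_{i,j\le t}$, $K_t^{\mathrm D}=K^{\mathrm D}(z_1,\dots,z_t)$ and $k_t^{\mathrm D}(z)=(k^{\mathrm D}(z_i,z))_{i\le t}$, define $$\gamma_t^{\mathrm D}=\sup_{w_1,\dots,w_t\in\mathcal Z}\tfrac12\log\det\big(I_t+(\lambda\kappa)^{-1}K^{\mathrm D}(w_1,\dots,w_t)\big),\qquad \beta_t^{\mathrm D}(\delta)=4LB+2L\sqrt{\tfrac{2\kappa}{\lambda}\big(\gamma_t^{\mathrm D}+\log\tfrac1\delta\big)},$$ $$\sigma_t^{\mathrm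 D}(z)=\sqrt{k^{\mathrm D}(z,z)-k_t^{\mathrm D}(z)^\top\big(K_t^{\mathrm D}+\lambda\kappa I_t\big)^{-1}k_t^{\mathrm D}(z)} .$$ Then, with probability at least $1-\delta$, the following holds simultaneously for all $t\ge1$. (a) If $\|h_t\|_{k^{\mathrm D}}\le B$, then for all $x,x'\in\mathcal X$ $$\big|s(h_t(x,x'))-s(f(x)-f(x'))\big|\le\beta_t^{\mathrm D}(\delta)\,\sigma_t^{\mathrm D}(x,x').$$ (b) Whatever the norm of $h_t$, the same bound holds for all $x,x'$ with $h_t$ replaced by any projection $h_t^P$ of $h_t$ to the ball of radius $B$, that is, any minimizer of $\|g_t(\theta)-g_t(h_t)\|_{V_t^{-1}}$ over $\theta\in\mathcal H_{k^{\mathrm D}}$ with $\|\theta\|_{k^{\mathrm D}}\le B$. Here $g_t(\theta)=\sum_{\tau\le t}s(\theta(z_\tau))\,k^{\mathrm D}(z_\tau,\cdot)+\lambda\theta$, $V_t=\sum_{\tau\le t}k^{\mathrm D}(z_\tau,\cdot)\otimes k^{\mathrm D}(z_\tau,\cdot)+\lambda\kappa I$ and $\|u\|_{V_t^{-1}}^2=\langle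 u,V_t^{-1}u\rangle$. -/

import Mathlib

open MeasureTheory

namespace Dueling

noncomputable section

/-- `H` is the reproducing kernel Hilbert space of the real-valued kernel `K` on `Z`: it is a
Hilbert space of functions on `Z` whose reproducing kernel is `K`. -/
def IsRKHSOf {Z : Type*} (H : Type*) [NormedAddCommGroup H] [InnerProductSpace ℝ H]
    [CompleteSpace H] [RKHS ℝ H Z ℝ] (K : Z → Z → ℝ) : Prop :=
  ∀ z w : Z, RKHS.kernel H z w 1 = K z w

/-- The dueling kernel
`k((x₁, x₁'), (x₂, x₂')) = k(x₁, x₂) + k(x₁', x₂') - k(x₁, x₂') - k(x₁', x₂)`. -/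
def duelingKernel {X : Type*} (k : X → X → ℝ) (z w : X × X) : ℝ :=
  k z.1 w.1 + k z.2 w.2 - k z.1 w.2 - k z.2 w.1

/-- The derivative `s(a) (1 - s(a))` of the sigmoid `s(a) = 1 / (1 + exp (-a))`. -/
def sigmoidDeriv (a : ℝ) : ℝ := Real.sigmoid a * (1 - Real.sigmoid a)

/-- The radius `R = B · sup_z √K(z, z)`: a function of norm at most `B` in the reproducing kernel
Hilbert space of `K` takes its values in `[-R, R]`. It is `B` for a normalized kernel. -/
def valueRadius {Z : Type*} (K : Z → Z → ℝ) (B : ℝ) : ℝ := B * ⨆ z : Z, √(K z z)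

/-- `κ = sup 1 / s'(a)` over `|a| ≤ R`. -/
def kappa {Z : Type*} (K : Z → Z → ℝ) (B : ℝ) : ℝ :=
  sSup ((fun a : ℝ => 1 / sigmoidDeriv a) '' {a | |a| ≤ valueRadius K B})

/-- `L = sup s'(a)` over `|a| ≤ R`. -/
def lipschitzConst {Z : Type*} (K : Z → Z → ℝ) (B : ℝ) : ℝ :=
  sSup (sigmoidDeriv '' {a | |a| ≤ valueRadius K B})

/-- The kernel matrix `[K(z_i, z_j)]` of the first `t` points. -/
def kernelMatrix {Z : Type*} (K : Z → Z → ℝ) {t : ℕ} (z : Fin t → Z) :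
    Matrix (Fin t) (Fin t) ℝ :=
  Matrix.of fun i j => K (z i) (z j)

/-- The information gain
`γ_t = sup_{z_1, …, z_t} ½ log det (I_t + ρ⁻¹ K_t)`, with `ρ = λ κ`. -/
def infoGain {Z : Type*} (K : Z → Z → ℝ) (rho : ℝ) (t : ℕ) : ℝ :=
  ⨆ z : Fin t → Z, (1 / 2) * Real.log (1 + rho⁻¹ • kernelMatrix K z).det

/-- `β_t(δ) = 4 L B + 2 L √((2 κ / λ) (γ_t + log (1 / δ)))`. -/
def beta {Z : Type*} (K : Z → Z → ℝ) (B lam δ : ℝ) (t : ℕ) : ℝ :=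
  4 * lipschitzConst K B * B + 2 * lipschitzConst K B *
    √(2 * kappa K B / lam * (infoGain K (lam * kappa K B) t + Real.log (1 / δ)))

/-- `σ_t(w) = √(K(w, w) - k_t(w)ᵀ (K_t + ρ I_t)⁻¹ k_t(w))`, with `ρ = λ κ` and
`k_t(w) = (K(z_1, w), …, K(z_t, w))`. -/
def sigma {Z : Type*} (K : Z → Z → ℝ) (rho : ℝ) {t : ℕ} (z : Fin t → Z) (w : Z) : ℝ :=
  √(K w w - (fun i => K (z i) w) ⬝ᵥ
    (Matrix.mulVec (kernelMatrix K z + rho • (1 : Matrix (Fin t) (Fin t) ℝ))⁻¹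
      (fun i => K (z i) w)))

section Loss

variable {Z : Type*} {H : Type*} [NormedAddCommGroup H] [InnerProductSpace ℝ H]
  [RKHS ℝ H Z ℝ]

/-- The regularized logistic negative log-likelihood of the first `t` observations
`(z 0, y 0), …, (z (t-1), y (t-1))`. -/
def logisticLoss (lam : ℝ) (t : ℕ) (z : ℕ → Z) (y : ℕ → ℝ) (g : H) : ℝ :=
  ∑ i ∈ Finset.range t,
      (-(y i) * Real.log (Real.sigmoid (g (z i)))
        - (1 - y i) * Real.log (1 - Real.sigmoid (g (z i))))
    + lam / 2 * ‖g‖ ^ 2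

variable [CompleteSpace H]

/-- The operator `V_t = ∑_{i < t} φ(z_i) φ(z_i)ᵀ + ρ I` on `H`, where `φ(z) = K(z, ·)`. -/
def covOp (rho : ℝ) (t : ℕ) (z : ℕ → Z) : H →L[ℝ] H :=
  ∑ i ∈ Finset.range t,
      InnerProductSpace.rankOne ℝ (RKHS.kerFun H (z i) 1) (RKHS.kerFun H (z i) 1)
    + rho • ContinuousLinearMap.id ℝ H

/-- The map `g_t(θ) = ∑_{i < t} s(θ(z_i)) φ(z_i) + λ θ`. -/
def gradMap (lam : ℝ) (t : ℕ) (z : ℕ → Z) (g : H) : H :=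
  ∑ i ∈ Finset.range t, Real.sigmoid (g (z i)) • RKHS.kerFun H (z i) 1 + lam • g

/-- The norm `‖u‖_{V⁻¹} = √⟨u, V⁻¹ u⟩` (for an invertible positive operator `V`). -/
def invNorm (V : H →L[ℝ] H) (u : H) : ℝ := √(inner ℝ u (V.inverse u))

/-- `p` is a projection of `g` to the ball of radius `B` of `H`: it minimizes
`‖g_t(θ) - g_t(g)‖_{V_t⁻¹}` over `‖θ‖ ≤ B`. -/
def IsBallProjection (B lam rho : ℝ) (t : ℕ) (z : ℕ → Z) (g p : H) : Prop :=
  ‖p‖ ≤ B ∧ ∀ θ : H, ‖θ‖ ≤ B →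
    invNorm (covOp rho t z) (gradMap lam t z p - gradMap lam t z g) ≤
      invNorm (covOp rho t z) (gradMap lam t z θ - gradMap lam t z g)

end Loss

end

end Dueling

/-! The difference `f x - f x'` is a function `fD` of norm at most `B` in the dueling RKHS
(`IsRKHSOf.exists_eq_inner`). The problem is thus logistic regression there, with features φ(z) and
noise e_i = y_i - s(fD(z_i)).

Deterministic half (`IsRKHSOf.abs_sigmoid_sub_le_of_noise`). Stationarity of `h_t` gives g_t(h_t) -
g_t(fD) = S_t - λ fD, where S_t = ∑ e_i φ(z_i). The projection `p` is at least as close to `h_t` as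
`fD` is, so ‖g_t(p) - g_t(fD)‖ in the V_t⁻¹-norm is at most twice that of S_t - λ fD. On the ball s'
≥ 1/κ, so ‖p - fD‖ in the V_t-norm is at most κ times that quantity. Duality of the two norms bounds
p(w) - fD(w), since σ_t(w) = √(λκ) ‖φ(w)‖ in the V_t⁻¹-norm; s is L-Lipschitz on the range. Part (a)
is the case where `h_t` is its own projection.

Probabilistic half. The process exp(½‖S_t‖²) / √det(I + ρ⁻¹ K_t), with the V_t⁻¹-norm and ρ = λκ, is
a supermartingale starting at 1. No Gaussian measure on the RKHS is needed: by Sherman–Morrison and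
a Schur complement, its one-step factor depends only on two scalars, the Gaussian-process posterior
mean a and variance q at the new point. Its conditional mean is at most 1 by integrating the
sub-Gaussian bound for Bernoulli noise against N(a, q) (`bernoulli_mixture_le`). Ville's inequality
at level 1/δ then controls ‖S_t‖ for all t at once. -/

namespace Dueling

/-! ### Positive operators and the norms of V and V⁻¹. -/

section PositiveOperator

variable {H : Type*} [NormedAddCommGroup H] [InnerProductSpace ℝ H]

/-- Cauchy–Schwarz for a possibly degenerate form: the quadratic c ↦ ⟨u + cv, T(u + cv)⟩ is
nonnegative, so its discriminant is not positive. -/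
lemma inner_sq_le_of_isPositive {T : H →L[ℝ] H} (hT : T.IsPositive) (u v : H) :
    inner ℝ u (T v) ^ 2 ≤ inner ℝ u (T u) * inner ℝ v (T v) := by
  have hsymm : inner ℝ v (T u) = inner ℝ u (T v) := by
    rw [← hT.inner_left_eq_inner_right, real_inner_comm]
  have key : ∀ c : ℝ, 0 ≤ inner ℝ v (T v) * (c * c) + 2 * inner ℝ u (T v) * c
      + inner ℝ u (T u) := fun c => by
    have h := hT.inner_nonneg_right (u + c • v)
    simp only [map_add, map_smul, inner_add_left, inner_add_right, inner_smul_left,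
      inner_smul_right, hsymm] at h
    simp at h
    linarith
  have := discrim_le_zero key
  unfold discrim at this
  nlinarith

lemma isPositive_inverse {V : H →L[ℝ] H} (hV : V.IsPositive) (hVi : V.IsInvertible) :
    V.inverse.IsPositive := by
  rw [ContinuousLinearMap.isPositive_iff]
  refine ⟨fun u v => ?_, fun u => ?_⟩
  · have h := hV.inner_left_eq_inner_right (V.inverse u) (V.inverse v)
    rw [hVi.self_apply_inverse, hVi.self_apply_inverse] at h
    exact h.symm
  · have h := hV.inner_nonneg_right (V.inverse u)
    rwa [hVi.self_apply_inverse] at h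

lemma invNorm_sq {V : H →L[ℝ] H} (hV : V.IsPositive) (hVi : V.IsInvertible) (u : H) :
    invNorm V u ^ 2 = inner ℝ u (V.inverse u) :=
  Real.sq_sqrt ((isPositive_inverse hV hVi).inner_nonneg_right u)

lemma invNorm_nonneg (V : H →L[ℝ] H) (u : H) : 0 ≤ invNorm V u := Real.sqrt_nonneg _

lemma invNorm_neg (V : H →L[ℝ] H) (u : H) : invNorm V (-u) = invNorm V u := by
  simp [invNorm]

lemma abs_inner_inverse_le {V : H →L[ℝ] H} (hV : V.IsPositive) (hVi : V.IsInvertible)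
    (u v : H) : |inner ℝ u (V.inverse v)| ≤ invNorm V u * invNorm V v := by
  refine abs_le_of_sq_le_sq ?_ (mul_nonneg (invNorm_nonneg V u) (invNorm_nonneg V v))
  rw [mul_pow, invNorm_sq hV hVi, invNorm_sq hV hVi]
  exact inner_sq_le_of_isPositive (isPositive_inverse hV hVi) u v

lemma invNorm_add_le {V : H →L[ℝ] H} (hV : V.IsPositive) (hVi : V.IsInvertible)
    (u v : H) : invNorm V (u + v) ≤ invNorm V u + invNorm V v := by
  refine abs_le_of_sq_le_sq' ?_ (add_nonneg (invNorm_nonneg V u) (invNorm_nonneg V v)) |>.2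
  have hsymm : inner ℝ v (V.inverse u) = inner ℝ u (V.inverse v) := by
    rw [← (isPositive_inverse hV hVi).inner_left_eq_inner_right, real_inner_comm]
  have h := (abs_le.1 (abs_inner_inverse_le hV hVi u v)).2
  rw [add_sq, invNorm_sq hV hVi, invNorm_sq hV hVi, invNorm_sq hV hVi]
  simp only [map_add, inner_add_left, inner_add_right, hsymm]
  linarith

/-- Duality of the V⁻¹-norm and the V-norm: write v = V⁻¹(V v) and apply Cauchy–Schwarz for V⁻¹. -/
lemma abs_inner_le_invNorm {V : H →L[ℝ] H} (hV : V.IsPositive) (hVi : V.IsInvertible)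
    (u v : H) : |inner ℝ u v| ≤ invNorm V u * √(inner ℝ v (V v)) := by
  have h := abs_inner_inverse_le hV hVi u (V v)
  rw [hVi.inverse_apply_self] at h
  rwa [invNorm, invNorm, hVi.inverse_apply_self, real_inner_comm v (V v)] at h

end PositiveOperator

/-! ### The covariance operator and its rank-one updates. -/

section CovarianceOperator

variable {Z : Type*} {H : Type*} [NormedAddCommGroup H] [InnerProductSpace ℝ H]
  [CompleteSpace H] [RKHS ℝ H Z ℝ]

lemma inner_kerFun_one (u : H) (z : Z) : inner ℝ u (RKHS.kerFun H z 1) = u z := by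
  rw [RKHS.inner_kerFun]; simp

lemma kerFun_one_inner (u : H) (z : Z) : inner ℝ (RKHS.kerFun H z 1) u = u z := by
  rw [RKHS.kerFun_inner]; simp

lemma covOp_apply (rho : ℝ) (t : ℕ) (z : ℕ → Z) (u : H) :
    covOp rho t z u
      = ∑ i ∈ Finset.range t, u (z i) • RKHS.kerFun H (z i) 1 + rho • u := by
  simp [covOp, -RKHS.inner_kerFun, -RKHS.kerFun_inner,
    kerFun_one_inner]

lemma inner_covOp_self (rho : ℝ) (t : ℕ) (z : ℕ → Z) (u : H) :
    inner ℝ u (covOp rho t z u) = ∑ i ∈ Finset.range t, u (z i) ^ 2 + rho * ‖u‖ ^ 2 := by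
  rw [covOp_apply, inner_add_right, inner_sum, inner_smul_right, real_inner_self_eq_norm_sq]
  simp only [inner_smul_right, inner_kerFun_one, sq]

lemma isPositive_covOp {rho : ℝ} (hrho : 0 < rho) (t : ℕ) (z : ℕ → Z) :
    (covOp rho t z : H →L[ℝ] H).IsPositive := by
  unfold covOp
  refine (ContinuousLinearMap.isPositive_sum _ fun i _ =>
    InnerProductSpace.isPositive_rankOne_self _).add ?_
  exact ContinuousLinearMap.isPositive_id.smul_of_nonneg hrho.le

/-- Coercivity: ⟨V u, u⟩ ≥ ρ‖u‖². -/
lemma isInvertible_covOp {rho : ℝ} (hrho : 0 < rho) (t : ℕ) (z : ℕ → Z) :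
    (covOp rho t z : H →L[ℝ] H).IsInvertible := by
  have hu : IsUnit (covOp rho t z : H →L[ℝ] H) := by
    refine ContinuousLinearMap.isUnit_of_forall_le_norm_inner_map _ (c := NNReal.mk rho hrho.le) hrho
      fun u => ?_
    rw [real_inner_comm, inner_covOp_self, Real.norm_eq_abs, NNReal.coe_mk]
    refine le_trans ?_ (le_abs_self _)
    have := Finset.sum_nonneg fun i (_ : i ∈ Finset.range t) => sq_nonneg (u (z i))
    nlinarith
  obtain ⟨v, hv⟩ := hu
  exact ⟨ContinuousLinearEquiv.ofUnit v, by rw [← hv]; rfl⟩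

lemma eq_inverse_covOp {rho : ℝ} (hrho : 0 < rho) {t : ℕ} {z : ℕ → Z} {u v : H}
    (h : covOp rho t z u = v) : (covOp rho t z : H →L[ℝ] H).inverse v = u := by
  rw [← h, (isInvertible_covOp hrho t z).inverse_apply_self]

/-- V ≥ ρI forces V⁻¹ ≤ ρ⁻¹I. This controls the bias term λ fD. -/
lemma invNorm_covOp_le {rho : ℝ} (hrho : 0 < rho) (t : ℕ) (z : ℕ → Z) (u : H) :
    invNorm (covOp rho t z) u ≤ ‖u‖ / √rho := by
  set V : H →L[ℝ] H := covOp rho t z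
  set w := V.inverse u
  have hw : V w = u := (isInvertible_covOp hrho t z).self_apply_inverse u
  have h1 : rho * ‖w‖ ^ 2 ≤ inner ℝ u w := by
    rw [← hw, real_inner_comm, inner_covOp_self]
    have := Finset.sum_nonneg fun i (_ : i ∈ Finset.range t) => sq_nonneg (w (z i))
    linarith
  have h2 : inner ℝ u w ≤ ‖u‖ * ‖w‖ := real_inner_le_norm u w
  have hsq : inner ℝ u w ≤ (‖u‖ / √rho) ^ 2 := by
    rw [div_pow, Real.sq_sqrt hrho.le, le_div_iff₀ hrho]
    rcases (norm_nonneg w).eq_or_lt with h0 | h0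
    · rw [← h0, mul_zero] at h2; nlinarith [sq_nonneg ‖u‖]
    · have h3 : rho * ‖w‖ ≤ ‖u‖ := le_of_mul_le_mul_right (by nlinarith) h0
      nlinarith [norm_nonneg u]
  exact Real.sqrt_le_iff.2 ⟨by positivity, hsq⟩

/-- The posterior kernel `⟨φ(a), V_t⁻¹ φ(b)⟩`. -/
noncomputable def posteriorKernel (H : Type*) [NormedAddCommGroup H] [InnerProductSpace ℝ H]
    [CompleteSpace H] [RKHS ℝ H Z ℝ] (rho : ℝ) (t : ℕ) (z : ℕ → Z) (a b : Z) : ℝ :=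
  (covOp rho t z : H →L[ℝ] H).inverse (RKHS.kerFun H b 1) a

/-- The noise vector `∑_{i < t} e_i φ(z_i)`. -/
noncomputable def noiseSum (H : Type*) [NormedAddCommGroup H] [InnerProductSpace ℝ H]
    [CompleteSpace H] [RKHS ℝ H Z ℝ] (t : ℕ) (z : ℕ → Z) (e : ℕ → ℝ) : H :=
  ∑ i ∈ Finset.range t, e i • RKHS.kerFun H (z i) 1

/-- The posterior mean `⟨φ(a), V_t⁻¹ ∑_{i < t} e_i φ(z_i)⟩`. -/
noncomputable def posteriorMean (H : Type*) [NormedAddCommGroup H] [InnerProductSpace ℝ H]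
    [CompleteSpace H] [RKHS ℝ H Z ℝ] (rho : ℝ) (t : ℕ) (z : ℕ → Z) (e : ℕ → ℝ) (a : Z) : ℝ :=
  (covOp rho t z : H →L[ℝ] H).inverse (noiseSum H t z e) a

lemma posteriorKernel_eq_inner (rho : ℝ) (t : ℕ) (z : ℕ → Z) (a b : Z) :
    posteriorKernel H rho t z a b = inner ℝ (RKHS.kerFun H a 1 : H)
      ((covOp rho t z : H →L[ℝ] H).inverse (RKHS.kerFun H b 1)) := by
  rw [kerFun_one_inner]; rfl

lemma posteriorKernel_self_nonneg {rho : ℝ} (hrho : 0 < rho) (t : ℕ) (z : ℕ → Z) (a : Z) :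
    0 ≤ posteriorKernel H rho t z a a := by
  rw [posteriorKernel_eq_inner]
  exact (isPositive_inverse (isPositive_covOp hrho t z)
    (isInvertible_covOp hrho t z)).inner_nonneg_right _

/-- Sherman–Morrison. -/
lemma inverse_covOp_succ {rho : ℝ} (hrho : 0 < rho) (t : ℕ) (z : ℕ → Z) (u : H) :
    (covOp rho (t + 1) z : H →L[ℝ] H).inverse u = (covOp rho t z : H →L[ℝ] H).inverse u
      - ((covOp rho t z : H →L[ℝ] H).inverse u (z t)
          / (1 + posteriorKernel H rho t z (z t) (z t))) •
        (covOp rho t z : H →L[ℝ] H).inverse (RKHS.kerFun H (z t) 1) := by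
  set q := posteriorKernel H rho t z (z t) (z t) with hq
  have hq0 : 0 ≤ q := posteriorKernel_self_nonneg hrho t z (z t)
  have hs : ∀ v : H, covOp rho (t + 1) z v
      = covOp rho t z v + v (z t) • RKHS.kerFun H (z t) 1 := fun v => by
    rw [covOp_apply, covOp_apply, Finset.sum_range_succ]; abel
  apply eq_inverse_covOp hrho
  rw [hs, map_sub, map_smul, (isInvertible_covOp hrho t z).self_apply_inverse,
    (isInvertible_covOp hrho t z).self_apply_inverse, RKHS.coe_sub, RKHS.coe_smul,
    Pi.sub_apply, Pi.smul_apply]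
  change _ + (_ - _ • q) • _ = u
  rw [sub_add, ← sub_smul, smul_eq_mul]
  have : (1 + q) ≠ 0 := by positivity
  convert sub_zero u
  rw [show ∀ b : ℝ, b / (1 + q) - (b - b / (1 + q) * q) = 0 from fun b => by field_simp; ring,
    zero_smul]

lemma inverse_covOp_apply_symm {rho : ℝ} (hrho : 0 < rho) (t : ℕ) (z : ℕ → Z) (u v : H) :
    inner ℝ u ((covOp rho t z : H →L[ℝ] H).inverse v)
      = inner ℝ v ((covOp rho t z : H →L[ℝ] H).inverse u) := by
  rw [← (isPositive_inverse (isPositive_covOp hrho t z)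
    (isInvertible_covOp hrho t z)).inner_left_eq_inner_right, real_inner_comm]

/-- Scalar form of Sherman–Morrison. With the recursion for the mean, it allows measurability to be
proved by induction on real-valued functions, without measuring operators. -/
lemma posteriorKernel_succ {rho : ℝ} (hrho : 0 < rho) (t : ℕ) (z : ℕ → Z) (a b : Z) :
    posteriorKernel H rho (t + 1) z a b = posteriorKernel H rho t z a b
      - posteriorKernel H rho t z (z t) b / (1 + posteriorKernel H rho t z (z t) (z t))
        * posteriorKernel H rho t z a (z t) := by
  rw [posteriorKernel, inverse_covOp_succ hrho, RKHS.coe_sub, RKHS.coe_smul]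
  rfl

lemma posteriorMean_succ {rho : ℝ} (hrho : 0 < rho) (t : ℕ) (z : ℕ → Z) (e : ℕ → ℝ) (a : Z) :
    posteriorMean H rho (t + 1) z e a = posteriorMean H rho t z e a
      + e t * posteriorKernel H rho t z a (z t)
      - (posteriorMean H rho t z e (z t) + e t * posteriorKernel H rho t z (z t) (z t))
        / (1 + posteriorKernel H rho t z (z t) (z t)) * posteriorKernel H rho t z a (z t) := by
  rw [posteriorMean, inverse_covOp_succ hrho]
  simp only [noiseSum, Finset.sum_range_succ, map_add, map_smul, RKHS.coe_sub, RKHS.coe_add,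
    RKHS.coe_smul, Pi.sub_apply, Pi.add_apply, Pi.smul_apply]
  rfl

/-- The recursion for `‖∑ e_i φ(z_i)‖²` in the norm of `V_t⁻¹`. -/
lemma invNorm_noiseSum_succ_sq {rho : ℝ} (hrho : 0 < rho) (t : ℕ) (z : ℕ → Z) (e : ℕ → ℝ) :
    invNorm (covOp rho (t + 1) z) (noiseSum H (t + 1) z e) ^ 2
      = invNorm (covOp rho t z) (noiseSum H t z e) ^ 2
        + (2 * e t * posteriorMean H rho t z e (z t)
            + e t ^ 2 * posteriorKernel H rho t z (z t) (z t)
            - posteriorMean H rho t z e (z t) ^ 2)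
          / (1 + posteriorKernel H rho t z (z t) (z t)) := by
  rw [invNorm_sq (isPositive_covOp hrho _ z) (isInvertible_covOp hrho _ z),
    invNorm_sq (isPositive_covOp hrho _ z) (isInvertible_covOp hrho _ z),
    inverse_covOp_succ hrho]
  have hq0 := posteriorKernel_self_nonneg (H := H) hrho t z (z t)
  have h1 : inner ℝ (noiseSum H t z e) ((covOp rho t z : H →L[ℝ] H).inverse
      (RKHS.kerFun H (z t) 1)) = posteriorMean H rho t z e (z t) := by
    rw [inverse_covOp_apply_symm hrho, kerFun_one_inner]; rfl
  have h2 : ((covOp rho t z : H →L[ℝ] H).inverse (noiseSum H t z e)) (z t)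
    = posteriorMean H rho t z e (z t) := rfl
  have h3 : ((covOp rho t z : H →L[ℝ] H).inverse (RKHS.kerFun H (z t) 1)) (z t)
    = posteriorKernel H rho t z (z t) (z t) := rfl
  have h4 : noiseSum H (t + 1) z e = noiseSum H t z e + e t • RKHS.kerFun H (z t) 1 :=
    Finset.sum_range_succ _ _
  rw [h4]
  simp only [map_add, map_smul, inner_add_left, inner_add_right, inner_sub_right, inner_smul_right,
    real_inner_smul_left, h1, kerFun_one_inner, RKHS.coe_add, RKHS.coe_smul, Pi.add_apply,
    Pi.smul_apply, h2, h3, smul_eq_mul]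
  set q := posteriorKernel H rho t z (z t) (z t)
  have : (1 + q) ≠ 0 := by positivity
  field_simp
  ring

end CovarianceOperator

/-! ### One-dimensional Gaussian mixtures of Bernoulli noise. -/

section GaussianMixture

/-- Symmetrization: multiply by the mean of exp(-xY'), which is at least 1 for an independent copy
Y'. The product is 1 + 2p(1-p)(cosh x - 1) ≤ cosh x ≤ exp(x²/2). -/
lemma centered_bernoulli_mgf_le {p : ℝ} (hp0 : 0 ≤ p) (hp1 : p ≤ 1) (x : ℝ) :
    p * Real.exp ((1 - p) * x) + (1 - p) * Real.exp (-p * x) ≤ Real.exp (x ^ 2 / 2) := by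
  refine le_trans ?_ (Real.cosh_le_exp_half_sq x)
  have hA := Real.exp_pos ((1 - p) * x)
  have hC := Real.exp_pos (-p * x)
  have h1 : 1 ≤ p * Real.exp (-((1 - p) * x)) + (1 - p) * Real.exp (-(-p * x)) := by
    have e1 := mul_le_mul_of_nonneg_left (Real.add_one_le_exp (-((1 - p) * x))) hp0
    have e2 := mul_le_mul_of_nonneg_left (Real.add_one_le_exp (-(-p * x))) (sub_nonneg.2 hp1)
    nlinarith
  have h2 : Real.exp ((1 - p) * x) * Real.exp (-(-p * x)) = Real.exp x := by
    rw [← Real.exp_add]; congr 1; ring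
  have h3 : Real.exp (-p * x) * Real.exp (-((1 - p) * x)) = Real.exp (-x) := by
    rw [← Real.exp_add]; congr 1; ring
  have h4 : Real.exp ((1 - p) * x) * Real.exp (-((1 - p) * x)) = 1 := by
    rw [← Real.exp_add, add_neg_cancel, Real.exp_zero]
  have h5 : Real.exp (-p * x) * Real.exp (-(-p * x)) = 1 := by
    rw [← Real.exp_add, add_neg_cancel, Real.exp_zero]
  have hnn : 0 ≤ p * Real.exp ((1 - p) * x) + (1 - p) * Real.exp (-p * x) :=
    add_nonneg (mul_nonneg hp0 hA.le) (mul_nonneg (sub_nonneg.2 hp1) hC.le)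
  calc p * Real.exp ((1 - p) * x) + (1 - p) * Real.exp (-p * x)
      ≤ (p * Real.exp ((1 - p) * x) + (1 - p) * Real.exp (-p * x))
        * (p * Real.exp (-((1 - p) * x)) + (1 - p) * Real.exp (-(-p * x))) :=
        le_mul_of_one_le_right hnn h1
    _ = p ^ 2 * (Real.exp ((1 - p) * x) * Real.exp (-((1 - p) * x)))
        + (1 - p) ^ 2 * (Real.exp (-p * x) * Real.exp (-(-p * x)))
        + p * (1 - p) * (Real.exp ((1 - p) * x) * Real.exp (-(-p * x))
          + Real.exp (-p * x) * Real.exp (-((1 - p) * x))) := by ring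
    _ = 1 + 2 * (p * (1 - p)) * (Real.cosh x - 1) := by
        rw [h2, h3, h4, h5, Real.cosh_eq]; ring
    _ ≤ Real.cosh x := by
        have := Real.one_le_cosh x
        nlinarith [sq_nonneg (2 * p - 1)]

lemma gaussian_mixture_exponent {q : ℝ} (hq : 0 < q) (a e x : ℝ) :
    e * x - x ^ 2 / 2 - (x - a) ^ 2 / (2 * q)
      = (2 * e * a + e ^ 2 * q - a ^ 2) / (2 * (1 + q))
        + -((1 + q) / (2 * q)) * (x - (a + e * q) / (1 + q)) ^ 2 := by
  have : 1 + q ≠ 0 := by positivity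
  field_simp
  ring

lemma integrable_gaussian_mixture {q : ℝ} (hq : 0 < q) (a e : ℝ) :
    Integrable fun x : ℝ => Real.exp (e * x - x ^ 2 / 2 - (x - a) ^ 2 / (2 * q)) := by
  simp_rw [gaussian_mixture_exponent hq, Real.exp_add]
  exact ((integrable_exp_neg_mul_sq (b := (1 + q) / (2 * q)) (by positivity)).comp_sub_right
    _).const_mul _

lemma integral_gaussian_mixture {q : ℝ} (hq : 0 < q) (a e : ℝ) :
    ∫ x : ℝ, Real.exp (e * x - x ^ 2 / 2 - (x - a) ^ 2 / (2 * q))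
      = Real.exp ((2 * e * a + e ^ 2 * q - a ^ 2) / (2 * (1 + q)))
        * √(Real.pi / ((1 + q) / (2 * q))) := by
  simp_rw [gaussian_mixture_exponent hq, Real.exp_add]
  rw [integral_const_mul, integral_sub_right_eq_self
    (fun x : ℝ => Real.exp (-((1 + q) / (2 * q)) * x ^ 2)), integral_gaussian]

/-- One step of the method of mixtures, for centered Bernoulli noise. -/
lemma bernoulli_mixture_le {p q : ℝ} (hp0 : 0 ≤ p) (hp1 : p ≤ 1) (hq : 0 ≤ q) (a : ℝ) :
    p * Real.exp ((2 * (1 - p) * a + (1 - p) ^ 2 * q - a ^ 2) / (2 * (1 + q)))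
      + (1 - p) * Real.exp ((2 * (-p) * a + (-p) ^ 2 * q - a ^ 2) / (2 * (1 + q)))
      ≤ √(1 + q) := by
  -- For q = 0 the mixing law N(a, q) degenerates to a point mass at a, so the bound is used at x =
  -- a instead of being integrated.
  rcases hq.eq_or_lt with rfl | hq
  · have h := mul_le_mul_of_nonneg_right (centered_bernoulli_mgf_le hp0 hp1 a)
      (Real.exp_pos (-(a ^ 2 / 2))).le
    rw [← Real.exp_add, add_neg_cancel, Real.exp_zero, add_mul, mul_assoc, mul_assoc,
      ← Real.exp_add, ← Real.exp_add] at h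
    rw [add_zero, Real.sqrt_one]
    rw [show (2 * (1 - p) * a + (1 - p) ^ 2 * 0 - a ^ 2) / (2 * 1)
        = (1 - p) * a + -(a ^ 2 / 2) by ring,
      show (2 * -p * a + (-p) ^ 2 * 0 - a ^ 2) / (2 * 1) = -p * a + -(a ^ 2 / 2) by ring]
    exact h
  · have hint := integral_mono
      (((integrable_gaussian_mixture hq a (1 - p)).const_mul p).add
        ((integrable_gaussian_mixture hq a (-p)).const_mul (1 - p)))
      ((integrable_exp_neg_mul_sq (b := 1 / (2 * q)) (by positivity)).comp_sub_right a)
      (fun x => by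
        have h := mul_le_mul_of_nonneg_right (centered_bernoulli_mgf_le hp0 hp1 x)
          (Real.exp_pos (-(x ^ 2 / 2) - (x - a) ^ 2 / (2 * q))).le
        rw [← Real.exp_add, add_mul, mul_assoc, mul_assoc, ← Real.exp_add, ← Real.exp_add] at h
        simp only [Pi.add_apply]
        convert h using 4 <;> ring)
    simp only [Pi.add_apply] at hint
    rw [integral_add ((integrable_gaussian_mixture hq a (1 - p)).const_mul p)
        ((integrable_gaussian_mixture hq a (-p)).const_mul (1 - p)),
      integral_const_mul, integral_const_mul, integral_gaussian_mixture hq,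
      integral_gaussian_mixture hq,
      integral_sub_right_eq_self (fun x : ℝ => Real.exp (-(1 / (2 * q)) * x ^ 2)),
      integral_gaussian, ← mul_assoc, ← mul_assoc, ← add_mul] at hint
    have hpi := Real.pi_pos
    have hs : √(Real.pi / (1 / (2 * q)))
        = √(1 + q) * √(Real.pi / ((1 + q) / (2 * q))) := by
      rw [← Real.sqrt_mul (by positivity)]
      congr 1
      field_simp
    rw [hs] at hint
    exact le_of_mul_le_mul_right hint (by positivity)

end GaussianMixture

/-! ### Monotonicity and Lipschitz bounds for the sigmoid. -/

section Sigmoid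

lemma sigmoidDeriv_pos (a : ℝ) : 0 < sigmoidDeriv a :=
  mul_pos (Real.sigmoid_pos a) (sub_pos.2 (Real.sigmoid_lt_one a))

lemma continuous_sigmoidDeriv : Continuous sigmoidDeriv :=
  continuous_sigmoid.mul (continuous_const.sub continuous_sigmoid)

lemma isCompact_abs_le (R : ℝ) : IsCompact {a : ℝ | |a| ≤ R} := by
  have : {a : ℝ | |a| ≤ R} = Set.Icc (-R) R := by
    ext a; exact abs_le (a := a) (b := R)
  rw [this]
  exact isCompact_Icc

/-- Compactness of [-R, R] bounds the set, so `sSup` is a genuine supremum and not its default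
value; likewise for κ. -/
lemma sigmoidDeriv_le_lipschitzConst {Z : Type*} {K : Z → Z → ℝ} {B a : ℝ}
    (ha : |a| ≤ valueRadius K B) : sigmoidDeriv a ≤ lipschitzConst K B :=
  le_csSup ((isCompact_abs_le _).bddAbove_image continuous_sigmoidDeriv.continuousOn)
    (Set.mem_image_of_mem _ ha)

lemma inv_sigmoidDeriv_le_kappa {Z : Type*} {K : Z → Z → ℝ} {B a : ℝ}
    (ha : |a| ≤ valueRadius K B) : 1 / sigmoidDeriv a ≤ kappa K B := by
  refine le_csSup ((isCompact_abs_le _).bddAbove_image ?_)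
    (Set.mem_image_of_mem (fun a : ℝ => 1 / sigmoidDeriv a) ha)
  exact (continuous_const.div continuous_sigmoidDeriv
    fun a => (sigmoidDeriv_pos a).ne').continuousOn

lemma kappa_pos {Z : Type*} {K : Z → Z → ℝ} {B : ℝ} (hR : 0 ≤ valueRadius K B) :
    0 < kappa K B :=
  (one_div_pos.2 (sigmoidDeriv_pos 0)).trans_le (inv_sigmoidDeriv_le_kappa (by simpa using hR))

/-- Mean value theorem. The intermediate point stays in [-R, R], where κ and L apply. -/
lemma exists_sigmoid_sub_eq {R a b : ℝ} (ha : |a| ≤ R) (hb : |b| ≤ R) :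
    ∃ c, |c| ≤ R ∧ Real.sigmoid a - Real.sigmoid b = sigmoidDeriv c * (a - b) := by
  wlog hab : b ≤ a generalizing a b
  · obtain ⟨c, hc, h⟩ := this hb ha (le_of_not_ge hab)
    exact ⟨c, hc, by linarith⟩
  rcases hab.eq_or_lt with rfl | hab
  · exact ⟨b, hb, by simp⟩
  obtain ⟨c, hc, h⟩ := exists_hasDerivAt_eq_slope Real.sigmoid sigmoidDeriv hab
    continuous_sigmoid.continuousOn fun x _ => Real.hasDerivAt_sigmoid x
  refine ⟨c, abs_le.2 ⟨(abs_le.1 hb).1.trans hc.1.le, hc.2.le.trans (abs_le.1 ha).2⟩, ?_⟩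
  rw [h, div_mul_cancel₀ _ (sub_pos.2 hab).ne']

lemma abs_sigmoid_sub_le {Z : Type*} {K : Z → Z → ℝ} {B a b : ℝ}
    (ha : |a| ≤ valueRadius K B) (hb : |b| ≤ valueRadius K B) :
    |Real.sigmoid a - Real.sigmoid b| ≤ lipschitzConst K B * |a - b| := by
  obtain ⟨c, hc, h⟩ := exists_sigmoid_sub_eq ha hb
  rw [h, abs_mul, abs_of_pos (sigmoidDeriv_pos c)]
  exact mul_le_mul_of_nonneg_right (sigmoidDeriv_le_lipschitzConst hc) (abs_nonneg _)

lemma sq_le_kappa_mul_sigmoid_sub {Z : Type*} {K : Z → Z → ℝ} {B a b : ℝ}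
    (ha : |a| ≤ valueRadius K B) (hb : |b| ≤ valueRadius K B) :
    (a - b) ^ 2 ≤ kappa K B * ((Real.sigmoid a - Real.sigmoid b) * (a - b)) := by
  obtain ⟨c, hc, h⟩ := exists_sigmoid_sub_eq ha hb
  have h1 := (div_le_iff₀ (sigmoidDeriv_pos c)).1 (inv_sigmoidDeriv_le_kappa hc)
  rw [h]
  nlinarith [mul_le_mul_of_nonneg_right h1 (sq_nonneg (a - b))]

lemma hasDerivAt_logisticLoss_scalar (y a : ℝ) :
    HasDerivAt (fun a => -y * Real.log (Real.sigmoid a) - (1 - y) * Real.log (1 - Real.sigmoid a))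
      (Real.sigmoid a - y) a := by
  have hs := Real.hasDerivAt_sigmoid a
  have h0 := (Real.sigmoid_pos a).ne'
  have h1 := (sub_pos.2 (Real.sigmoid_lt_one a)).ne'
  have h := ((hs.log h0).const_mul (-y)).fun_sub (((hs.const_sub 1).log h1).const_mul (1 - y))
  have e : -y * (Real.sigmoid a * (1 - Real.sigmoid a) / Real.sigmoid a)
      - (1 - y) * (-(Real.sigmoid a * (1 - Real.sigmoid a)) / (1 - Real.sigmoid a))
      = Real.sigmoid a - y := by
    field_simp
    ring
  rwa [e] at h

end Sigmoid

/-! ### First-order optimality. -/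

section Minimizer

variable {Z : Type*} {H : Type*} [NormedAddCommGroup H] [InnerProductSpace ℝ H]
  [CompleteSpace H] [RKHS ℝ H Z ℝ]

/-- The first-order condition for a minimizer of the regularized logistic loss. -/
lemma gradMap_eq_of_isMinOn {lam : ℝ} {t : ℕ} {z : ℕ → Z} {y : ℕ → ℝ} {g : H}
    (hg : IsMinOn (logisticLoss (H := H) lam t z y) Set.univ g) :
    gradMap lam t z g = ∑ i ∈ Finset.range t, y i • RKHS.kerFun H (z i) 1 := by
  rw [← sub_eq_zero]
  refine ext_inner_right ℝ fun v => ?_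
  rw [inner_zero_left]
  -- Differentiating along each line g + u v suffices: the directional derivative is the inner
  -- product of v with the desired difference.
  have hline : ∀ i, HasDerivAt (fun u : ℝ => (g + u • v) (z i)) (v (z i)) 0 := fun i => by
    simp only [RKHS.coe_add, RKHS.coe_smul, Pi.add_apply, Pi.smul_apply, smul_eq_mul]
    simpa using ((hasDerivAt_id (0 : ℝ)).mul_const (v (z i))).const_add (g (z i))
  have hd : HasDerivAt (fun u : ℝ => logisticLoss lam t z y (g + u • v))
      (∑ i ∈ Finset.range t, (Real.sigmoid (g (z i)) - y i) * v (z i)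
        + lam / 2 * (2 * inner ℝ g v)) 0 := by
    unfold logisticLoss
    refine (HasDerivAt.fun_sum fun i _ => ?_).add (HasDerivAt.const_mul _ ?_)
    · have h := hasDerivAt_logisticLoss_scalar (y i) (g (z i))
      have hz : g (z i) = (g + (0 : ℝ) • v) (z i) := by simp
      rw [hz] at h
      have := h.comp (0 : ℝ) (hline i)
      rw [← hz] at this
      exact this
    · have h : HasDerivAt (fun u : ℝ => g + u • v) v 0 := by
        simpa using ((hasDerivAt_id (0 : ℝ)).smul_const v).const_add g
      simpa using h.norm_sq
  have hmin : IsLocalMin (fun u : ℝ => logisticLoss lam t z y (g + u • v)) 0 :=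
    Filter.Eventually.of_forall fun u => by simpa using hg (Set.mem_univ (g + u • v))
  have := hmin.hasDerivAt_eq_zero hd
  rw [← this, gradMap]
  simp only [inner_sub_left, inner_add_left, sum_inner, real_inner_smul_left, kerFun_one_inner,
    sub_mul, Finset.sum_sub_distrib]
  ring

end Minimizer

/-! ### Kernel matrices, information gain and the RKHS. -/

section KernelMatrix

variable {Z : Type*} {H : Type*} [NormedAddCommGroup H] [InnerProductSpace ℝ H]
  [CompleteSpace H] [RKHS ℝ H Z ℝ] {K : Z → Z → ℝ}

lemma IsRKHSOf.kerFun_apply (hK : IsRKHSOf H K) (z w : Z) :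
    (RKHS.kerFun H w 1 : H) z = K z w := by
  rw [RKHS.kerFun_apply, hK]

lemma IsRKHSOf.inner_kerFun (hK : IsRKHSOf H K) (z w : Z) :
    inner ℝ (RKHS.kerFun H z 1 : H) (RKHS.kerFun H w 1) = K z w := by
  rw [kerFun_one_inner, hK.kerFun_apply]

lemma IsRKHSOf.symm (hK : IsRKHSOf H K) (z w : Z) : K z w = K w z := by
  rw [← hK.inner_kerFun, ← hK.inner_kerFun, real_inner_comm]

lemma IsRKHSOf.norm_kerFun (hK : IsRKHSOf H K) (z : Z) :
    ‖(RKHS.kerFun H z 1 : H)‖ = √(K z z) := by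
  rw [← hK.inner_kerFun, real_inner_self_eq_norm_sq, Real.sqrt_sq (norm_nonneg _)]

lemma IsRKHSOf.nonneg (hK : IsRKHSOf H K) (z : Z) : 0 ≤ K z z := by
  rw [← hK.inner_kerFun]; exact real_inner_self_nonneg

lemma IsRKHSOf.abs_apply_le (hK : IsRKHSOf H K) (u : H) (z : Z) :
    |u z| ≤ ‖u‖ * √(K z z) := by
  rw [← inner_kerFun_one, ← hK.norm_kerFun]
  exact abs_real_inner_le_norm _ _

lemma IsRKHSOf.abs_le_valueRadius (hK : IsRKHSOf H K) {C : ℝ} (hC : ∀ z, K z z ≤ C) {B : ℝ}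
    {u : H} (hu : ‖u‖ ≤ B) (z : Z) : |u z| ≤ valueRadius K B := by
  refine (hK.abs_apply_le u z).trans (mul_le_mul hu ?_ (Real.sqrt_nonneg _)
    ((norm_nonneg u).trans hu))
  exact le_ciSup (f := fun z => √(K z z))
    ⟨√C, by rintro _ ⟨w, rfl⟩; exact Real.sqrt_le_sqrt (hC w)⟩ z

lemma IsRKHSOf.posSemidef_kernelMatrix (hK : IsRKHSOf H K) {t : ℕ} (z : Fin t → Z) :
    (kernelMatrix K z).PosSemidef := by
  have : kernelMatrix K z = Matrix.gram ℝ fun i => (RKHS.kerFun H (z i) 1 : H) := by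
    ext i j
    rw [Matrix.gram_apply, hK.inner_kerFun]
    rfl
  rw [this]
  exact Matrix.posSemidef_gram ℝ _

lemma IsRKHSOf.posDef_kernelMatrix_add (hK : IsRKHSOf H K) {rho : ℝ} (hrho : 0 < rho) {t : ℕ}
    (z : Fin t → Z) : (kernelMatrix K z + rho • (1 : Matrix (Fin t) (Fin t) ℝ)).PosDef :=
  Matrix.PosDef.posSemidef_add (hK.posSemidef_kernelMatrix z) (Matrix.PosDef.one.smul hrho)

/-- The posterior variance `ρ ⟨φ(w), V_t⁻¹ φ(w)⟩` in terms of the kernel matrix. -/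
lemma IsRKHSOf.posteriorVariance_eq (hK : IsRKHSOf H K) {rho : ℝ} (hrho : 0 < rho) (t : ℕ)
    (z : ℕ → Z) (w : Z) :
    K w w - (fun i : Fin t => K (z i) w) ⬝ᵥ
        (Matrix.mulVec (kernelMatrix K (fun i : Fin t => z i)
          + rho • (1 : Matrix (Fin t) (Fin t) ℝ))⁻¹ (fun i : Fin t => K (z i) w))
      = rho * posteriorKernel H rho t z w w := by
  set A := kernelMatrix K (fun i : Fin t => z i) + rho • (1 : Matrix (Fin t) (Fin t) ℝ) with hA
  set kw : Fin t → ℝ := fun i => K (z i) w with hkw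
  set c := Matrix.mulVec A⁻¹ kw with hc
  have hAc : Matrix.mulVec A c = kw := by
    rw [hc, Matrix.mulVec_mulVec, Matrix.mul_nonsing_inv _
      (isUnit_iff_ne_zero.2 (hK.posDef_kernelMatrix_add hrho _).det_pos.ne'), Matrix.one_mulVec]
  have hi : ∀ i : Fin t, ∑ j : Fin t, K (z i) (z j) * c j + rho * c i = K (z i) w := fun i => by
    have := congrFun hAc i
    rw [hA, Matrix.add_mulVec, Matrix.smul_mulVec, Matrix.one_mulVec] at this
    exact this
  -- The candidate for ρ V⁻¹ φ(w), with c = (K_t + ρI)⁻¹ k_t(w). The linear system for c says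
  -- exactly u(z_i) = ρ c_i, which makes V u = ρ φ(w).
  set u : H := RKHS.kerFun H w 1 - ∑ j : Fin t, c j • RKHS.kerFun H (z j) 1 with hu
  have hua : ∀ a, u a = K a w - ∑ j : Fin t, K a (z j) * c j := fun a => by
    rw [← kerFun_one_inner, hu, inner_sub_right, inner_sum, hK.inner_kerFun]
    simp only [inner_smul_right, hK.inner_kerFun, mul_comm]
  have hV : covOp rho t z u = rho • RKHS.kerFun H w 1 := by
    rw [covOp_apply, Finset.sum_range]
    have : ∀ i : Fin t, u (z i) = rho * c i := fun i => by rw [hua]; linarith [hi i]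
    simp only [this]
    rw [hu, smul_sub, Finset.smul_sum]
    simp only [smul_smul]
    abel
  have hinv := eq_inverse_covOp hrho hV
  rw [map_smul] at hinv
  have h1 : rho * posteriorKernel H rho t z w w = u w := by
    rw [← hinv, RKHS.coe_smul]; rfl
  rw [h1, hua]
  simp only [dotProduct, hkw, hK.symm w]

lemma IsRKHSOf.sigma_eq (hK : IsRKHSOf H K) {rho : ℝ} (hrho : 0 < rho) (t : ℕ)
    (z : ℕ → Z) (w : Z) :
    sigma K rho (fun i : Fin t => z i) w
      = √rho * invNorm (covOp rho t z) (RKHS.kerFun H w 1 : H) := by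
  rw [sigma, hK.posteriorVariance_eq hrho t z w, Real.sqrt_mul hrho.le, posteriorKernel_eq_inner]
  rfl

lemma one_add_smul_kernelMatrix {rho : ℝ} (hrho : 0 < rho) {t : ℕ} (z : Fin t → Z) :
    1 + rho⁻¹ • kernelMatrix K z
      = rho⁻¹ • (kernelMatrix K z + rho • (1 : Matrix (Fin t) (Fin t) ℝ)) := by
  rw [smul_add, smul_smul, inv_mul_cancel₀ hrho.ne', one_smul, add_comm]

lemma IsRKHSOf.det_one_add_pos (hK : IsRKHSOf H K) {rho : ℝ} (hrho : 0 < rho) {t : ℕ}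
    (z : Fin t → Z) : 0 < (1 + rho⁻¹ • kernelMatrix K z).det := by
  rw [one_add_smul_kernelMatrix hrho]
  exact ((hK.posDef_kernelMatrix_add hrho z).smul (inv_pos.2 hrho)).det_pos

/-- The new factor is the Schur complement of the old block, which equals one plus the posterior
variance divided by ρ. -/
lemma IsRKHSOf.det_one_add_succ (hK : IsRKHSOf H K) {rho : ℝ} (hrho : 0 < rho) (t : ℕ)
    (z : ℕ → Z) :
    (1 + rho⁻¹ • kernelMatrix K (fun i : Fin (t + 1) => z i)).det
      = (1 + rho⁻¹ • kernelMatrix K (fun i : Fin t => z i)).det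
        * (1 + posteriorKernel H rho t z (z t) (z t)) := by
  set M := 1 + rho⁻¹ • kernelMatrix K (fun i : Fin t => z i) with hM
  set A := kernelMatrix K (fun i : Fin t => z i) + rho • (1 : Matrix (Fin t) (Fin t) ℝ) with hA
  have hMA : M = rho⁻¹ • A := one_add_smul_kernelMatrix hrho _
  have hMdet : IsUnit M.det := isUnit_iff_ne_zero.2 (hK.det_one_add_pos hrho _).ne'
  have hAdet : IsUnit A.det :=
    isUnit_iff_ne_zero.2 (hK.posDef_kernelMatrix_add hrho _).det_pos.ne'
  have hMinv : M⁻¹ = rho • A⁻¹ := by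
    refine Matrix.inv_eq_right_inv ?_
    rw [hMA, Matrix.smul_mul, Matrix.mul_smul, smul_smul, inv_mul_cancel₀ hrho.ne', one_smul,
      Matrix.mul_nonsing_inv _ hAdet]
  let := Matrix.invertibleOfIsUnitDet M hMdet
  set kw : Fin t → ℝ := fun i => K (z i) (z t) with hkw
  have hblock : Matrix.reindex finSumFinEquiv.symm finSumFinEquiv.symm
      (1 + rho⁻¹ • kernelMatrix K (fun i : Fin (t + 1) => z i))
      = Matrix.fromBlocks M (rho⁻¹ • Matrix.replicateCol (Fin 1) kw)
        (rho⁻¹ • Matrix.replicateRow (Fin 1) kw)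
        (Matrix.of fun _ _ => 1 + rho⁻¹ * K (z t) (z t)) := by
    ext i j
    rcases i with i | i <;> rcases j with j | j
    · simp [hM, kernelMatrix, Matrix.one_apply, Fin.ext_iff]
    · have : (i : ℕ) ≠ t := i.2.ne
      simp [kernelMatrix, Fin.ext_iff, this, hkw]
    · have : t ≠ (j : ℕ) := j.2.ne'
      simp [kernelMatrix, Fin.ext_iff, this, hkw, hK.symm (z t)]
    · simp [kernelMatrix, Matrix.one_apply, Fin.ext_iff]
  rw [← Matrix.det_reindex_self finSumFinEquiv.symm, hblock, Matrix.det_fromBlocks₁₁]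
  congr 1
  rw [Matrix.det_unique, Matrix.invOf_eq_nonsing_inv, hMinv]
  have hv := hK.posteriorVariance_eq hrho t z (z t)
  rw [← hA, ← hkw] at hv
  have hq : posteriorKernel H rho t z (z t) (z t)
      = rho⁻¹ * (K (z t) (z t) - kw ⬝ᵥ Matrix.mulVec A⁻¹ kw) := by
    rw [hv, inv_mul_cancel_left₀ hrho.ne']
  have hmul : ((rho⁻¹ • Matrix.replicateRow (Fin 1) kw) * (rho • A⁻¹)
      * (rho⁻¹ • Matrix.replicateCol (Fin 1) kw)) default default
      = rho⁻¹ * (kw ⬝ᵥ Matrix.mulVec A⁻¹ kw) := by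
    rw [Matrix.smul_mul _ _ (rho • A⁻¹), Matrix.mul_smul _ rho A⁻¹, smul_smul,
      inv_mul_cancel₀ hrho.ne', one_smul, Matrix.mul_smul, Matrix.smul_apply, smul_eq_mul, Matrix.dotProduct_mulVec]
    rfl
  rw [Matrix.sub_apply, hmul, hq, Matrix.of_apply]
  ring

lemma IsRKHSOf.half_log_det_le_infoGain (hK : IsRKHSOf H K) {C : ℝ} (hC : ∀ z, K z z ≤ C)
    {rho : ℝ} (hrho : 0 < rho) {t : ℕ} (z : Fin t → Z) :
    1 / 2 * Real.log (1 + rho⁻¹ • kernelMatrix K z).det ≤ infoGain K rho t := by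
  refine le_ciSup (f := fun z : Fin t → Z =>
    1 / 2 * Real.log (1 + rho⁻¹ • kernelMatrix K z).det) ?_ z
  -- Boundedness is needed for the real supremum to be meaningful. The Leibniz expansion bounds the
  -- determinant, since every entry is at most 1 + C/ρ in absolute value.
  refine ⟨1 / 2 * Real.log ((Fintype.card (Fin t)).factorial
    • (1 + rho⁻¹ * C) ^ Fintype.card (Fin t)), ?_⟩
  rintro _ ⟨w, rfl⟩
  refine mul_le_mul_of_nonneg_left (Real.log_le_log (hK.det_one_add_pos hrho w) ?_) (by norm_num)
  refine (le_abs_self _).trans (Matrix.det_le (abv := AbsoluteValue.abs) fun i j => ?_)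
  rw [AbsoluteValue.abs_apply, Matrix.add_apply, Matrix.smul_apply, smul_eq_mul]
  refine (abs_add_le _ _).trans (add_le_add ?_ ?_)
  · rw [Matrix.one_apply]; split_ifs <;> simp
  · rw [abs_mul, abs_of_pos (inv_pos.2 hrho)]
    refine mul_le_mul_of_nonneg_left ?_ (inv_pos.2 hrho).le
    change |K (w i) (w j)| ≤ C
    have h0 : 0 ≤ C := (hK.nonneg (w i)).trans (hC _)
    rw [← hK.inner_kerFun]
    refine (abs_real_inner_le_norm _ _).trans ?_
    rw [hK.norm_kerFun, hK.norm_kerFun, ← Real.sq_sqrt h0, sq]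
    exact mul_le_mul (Real.sqrt_le_sqrt (hC _)) (Real.sqrt_le_sqrt (hC _)) (Real.sqrt_nonneg _)
      (Real.sqrt_nonneg _)

lemma mem_closure_span_kerFun (u : H) :
    u ∈ closure (Submodule.span ℝ (Set.range fun z : Z => (RKHS.kerFun H z 1 : H)) : Set H) := by
  have hu : u ∈ (Submodule.span ℝ {RKHS.kerFun H x v | (x : Z) (v : ℝ)}).topologicalClosure := by
    rw [RKHS.kerFun_dense]; trivial
  refine Submodule.topologicalClosure_mono (Submodule.span_le.2 ?_) hu
  rintro _ ⟨x, v, rfl⟩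
  rw [show v = v • (1 : ℝ) by simp, map_smul]
  exact Submodule.smul_mem _ _ (Submodule.subset_span ⟨x, rfl⟩)

/-- Functions of a reproducing kernel Hilbert space are measurable when the kernel functions
are. -/
lemma IsRKHSOf.measurable_coe [MeasurableSpace Z] (hK : IsRKHSOf H K)
    (hm : ∀ w, Measurable fun z => K z w) (u : H) : Measurable (u : Z → ℝ) := by
  obtain ⟨s, hs, hlim⟩ := mem_closure_iff_seq_limit.1 (mem_closure_span_kerFun u)
  refine measurable_of_tendsto_metrizable (f := fun n => (s n : Z → ℝ)) (fun n => ?_)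
    (tendsto_pi_nhds.2 fun z => ((RKHS.continuous_eval z).tendsto u).comp hlim)
  refine Submodule.span_induction (p := fun (v : H) _ => Measurable (v : Z → ℝ))
    ?_ ?_ ?_ ?_ (hs n)
  · rintro _ ⟨x, rfl⟩
    rw [show ((RKHS.kerFun H x 1 : H) : Z → ℝ) = fun z => K z x from
      funext fun z => hK.kerFun_apply z x]
    exact hm x
  · rw [RKHS.coe_zero]; exact measurable_const
  · intro a b _ _ ha hb
    rw [RKHS.coe_add]; exact ha.add hb
  · intro c a _ ha
    rw [RKHS.coe_smul]; exact ha.const_smul c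

/-- If the kernel factors through a feature map `ψ` into a Hilbert space, then `⟨f, ψ(·)⟩` belongs
to its reproducing kernel Hilbert space, with norm at most `‖f‖`. -/
lemma IsRKHSOf.exists_eq_inner (hK : IsRKHSOf H K) {E : Type*} [NormedAddCommGroup E]
    [InnerProductSpace ℝ E] [CompleteSpace E] (ψ : Z → E)
    (hψ : ∀ z w, inner ℝ (ψ z) (ψ w) = K z w) (f : E) :
    ∃ g : H, ‖g‖ ≤ ‖f‖ ∧ ∀ z, g z = inner ℝ f (ψ z) := by
  set e : (Z →₀ ℝ) →ₗ[ℝ] H := Finsupp.linearCombination ℝ fun z => (RKHS.kerFun H z 1 : H)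
  set T : (Z →₀ ℝ) →ₗ[ℝ] E := Finsupp.linearCombination ℝ ψ
  have he : DenseRange e := by
    intro u
    rw [← LinearMap.coe_range, Finsupp.range_linearCombination]
    exact mem_closure_span_kerFun u
  have hnorm : ∀ c, ‖T c‖ ≤ 1 * ‖e c‖ := fun c => by
    rw [one_mul]
    refine abs_le_of_sq_le_sq' (le_of_eq ?_) (norm_nonneg _) |>.2
    rw [← real_inner_self_eq_norm_sq, ← real_inner_self_eq_norm_sq]
    simp only [T, e, Finsupp.linearCombination_apply, Finsupp.sum, inner_sum, sum_inner,
      inner_smul_right, real_inner_smul_left, hψ, hK.inner_kerFun]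
  -- Equal Gram matrices give ‖T c‖ = ‖e c‖, so φ(z) ↦ ψ(z) extends to a contraction S. The required
  -- function is S* f, as (S* f)(z) = ⟨f, S φ(z)⟩.
  set S : H →L[ℝ] E := T.extendOfNorm e
  refine ⟨S.adjoint f, ?_, fun z => ?_⟩
  · have hS : ‖S.adjoint‖ ≤ 1 := by
      rw [LinearIsometryEquiv.norm_map]
      exact LinearMap.opNorm_extendOfNorm_le he zero_le_one hnorm
    simpa using S.adjoint.le_of_opNorm_le hS f
  · rw [← inner_kerFun_one, ContinuousLinearMap.adjoint_inner_left]
    have := LinearMap.extendOfNorm_eq he ⟨1, hnorm⟩ (Finsupp.single z 1)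
    simp only [e, T, Finsupp.linearCombination_single, one_smul] at this
    rw [← this]

end KernelMatrix

/-! ### The deterministic confidence bound. -/

section ConfidenceBound

variable {Z : Type*} {H : Type*} [NormedAddCommGroup H] [InnerProductSpace ℝ H]
  [CompleteSpace H] [RKHS ℝ H Z ℝ] {K : Z → Z → ℝ}

/-- On the ball of radius `B`, the map `g_t` expands the `V_t`-norm by at least `1 / κ`. -/
lemma IsRKHSOf.sqrt_inner_covOp_le (hK : IsRKHSOf H K) {C : ℝ} (hC : ∀ z, K z z ≤ C)
    {B lam : ℝ} (hlam : 0 < lam) (t : ℕ) (z : ℕ → Z) {p f : H} (hp : ‖p‖ ≤ B) (hf : ‖f‖ ≤ B)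
    (hκ : 0 < kappa K B) :
    √(inner ℝ (p - f) (covOp (lam * kappa K B) t z (p - f)))
      ≤ kappa K B * invNorm (covOp (lam * kappa K B) t z)
          (gradMap lam t z p - gradMap lam t z f) := by
  have hrho : 0 < lam * kappa K B := mul_pos hlam hκ
  set V : H →L[ℝ] H := covOp (lam * kappa K B) t z
  set d := gradMap lam t z p - gradMap lam t z f with hd
  -- Strong monotonicity of s, summed over the data. The choice ρ = λκ makes the regularization
  -- terms agree exactly.
  have hle : inner ℝ (p - f) (V (p - f)) ≤ kappa K B * inner ℝ d (p - f) := by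
    have hdv : inner ℝ d (p - f) = ∑ i ∈ Finset.range t,
        (Real.sigmoid (p (z i)) - Real.sigmoid (f (z i))) * (p (z i) - f (z i))
        + lam * ‖p - f‖ ^ 2 := by
      have : d = ∑ i ∈ Finset.range t, (Real.sigmoid (p (z i)) - Real.sigmoid (f (z i))) •
          RKHS.kerFun H (z i) 1 + lam • (p - f) := by
        simp only [hd, gradMap, sub_smul, smul_sub, Finset.sum_sub_distrib]
        abel
      rw [this, inner_add_left, sum_inner, real_inner_smul_left, real_inner_self_eq_norm_sq]
      simp only [real_inner_smul_left, kerFun_one_inner, RKHS.coe_sub, Pi.sub_apply]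
    rw [hdv, inner_covOp_self, mul_add, Finset.mul_sum]
    refine add_le_add (Finset.sum_le_sum fun i _ => ?_) (le_of_eq (by ring))
    rw [RKHS.coe_sub, Pi.sub_apply]
    exact sq_le_kappa_mul_sigmoid_sub (hK.abs_le_valueRadius hC hp _)
      (hK.abs_le_valueRadius hC hf _)
  have hVpos : V.IsPositive := isPositive_covOp hrho t z
  have h1 := hle.trans (mul_le_mul_of_nonneg_left ((le_abs_self _).trans
    (abs_inner_le_invNorm hVpos (isInvertible_covOp hrho t z) d (p - f))) hκ.le)
  set s := √(inner ℝ (p - f) (V (p - f))) with hs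
  have hs2 : s * s = inner ℝ (p - f) (V (p - f)) :=
    Real.mul_self_sqrt (hVpos.inner_nonneg_right _)
  rcases (Real.sqrt_nonneg (inner ℝ (p - f) (V (p - f)))).eq_or_lt with h0 | h0
  · rw [hs, ← h0]
    exact mul_nonneg hκ.le (invNorm_nonneg _ _)
  · refine le_of_mul_le_mul_right ?_ (hs ▸ h0)
    rw [hs2, mul_assoc]
    exact h1

lemma beta_eq {B lam δ : ℝ} {t : ℕ} (hκ : 0 < kappa K B) (hlam : 0 < lam) :
    beta K B lam δ t = 4 * lipschitzConst K B * B + 2 * lipschitzConst K B *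
      (kappa K B / √(lam * kappa K B)
        * √(2 * (infoGain K (lam * kappa K B) t + Real.log (1 / δ)))) := by
  have h : kappa K B / √(lam * kappa K B) = √(kappa K B / lam) := by
    rw [Real.sqrt_mul hlam.le, Real.sqrt_div hκ.le]
    have := Real.sqrt_pos.2 hlam
    have := Real.sqrt_pos.2 hκ
    field_simp
    exact (Real.sq_sqrt hκ.le).symm
  rw [beta, h, ← Real.sqrt_mul (by positivity)]
  congr 3
  ring

/-- The confidence bound for the projected estimator, given a bound on the noise. -/
lemma IsRKHSOf.abs_sigmoid_sub_le_of_noise (hK : IsRKHSOf H K) {C : ℝ} (hC : ∀ z, K z z ≤ C)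
    {B lam δ : ℝ} (hlam : 0 < lam) {t : ℕ} {z : ℕ → Z} {y : ℕ → ℝ} {f g p : H} (hf : ‖f‖ ≤ B)
    (hg : IsMinOn (logisticLoss (H := H) lam t z y) Set.univ g)
    (hp : IsBallProjection B lam (lam * kappa K B) t z g p)
    (hnoise : invNorm (covOp (lam * kappa K B) t z)
      (noiseSum H t z fun i => y i - Real.sigmoid (f (z i)))
        ≤ √(2 * (infoGain K (lam * kappa K B) t + Real.log (1 / δ)))) (w : Z) :
    |Real.sigmoid (p w) - Real.sigmoid (f w)| ≤
      beta K B lam δ t * sigma K (lam * kappa K B) (fun i : Fin t => z i) w := by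
  have hB : 0 ≤ B := (norm_nonneg f).trans hf
  have hκ : 0 < kappa K B :=
    kappa_pos (mul_nonneg hB (Real.iSup_nonneg fun _ => Real.sqrt_nonneg _))
  have hrho : 0 < lam * kappa K B := mul_pos hlam hκ
  rw [beta_eq hκ hlam, hK.sigma_eq hrho]
  set rho := lam * kappa K B with hrho_def
  set V : H →L[ℝ] H := covOp rho t z with hV
  set N := √(2 * (infoGain K rho t + Real.log (1 / δ)))
  have hVp : V.IsPositive := isPositive_covOp hrho t z
  have hVi : V.IsInvertible := isInvertible_covOp hrho t z
  have hgf : invNorm V (gradMap lam t z g - gradMap lam t z f) ≤ N + lam * (B / √rho) := by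
    have : gradMap lam t z g - gradMap lam t z f
        = noiseSum H t z (fun i => y i - Real.sigmoid (f (z i))) + -(lam • f) := by
      rw [gradMap_eq_of_isMinOn hg]
      simp only [gradMap, noiseSum, sub_smul, Finset.sum_sub_distrib]
      abel
    rw [this]
    refine (invNorm_add_le hVp hVi _ _).trans (add_le_add hnoise ?_)
    rw [invNorm_neg]
    refine (invNorm_covOp_le hrho t z _).trans ?_
    rw [norm_smul, Real.norm_of_nonneg hlam.le, mul_div_assoc]
    gcongr
  have hpf : invNorm V (gradMap lam t z p - gradMap lam t z f)
      ≤ 2 * (N + lam * (B / √rho)) := by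
    have : gradMap lam t z p - gradMap lam t z f = (gradMap lam t z p - gradMap lam t z g)
        + (gradMap lam t z g - gradMap lam t z f) := by abel
    rw [this]
    refine (invNorm_add_le hVp hVi _ _).trans ?_
    have h1 := hp.2 f hf
    rw [← hV, ← neg_sub (gradMap lam t z g) (gradMap lam t z f), invNorm_neg] at h1
    linarith
  have hL : 0 ≤ lipschitzConst K B := (sigmoidDeriv_pos (f w)).le.trans
    (sigmoidDeriv_le_lipschitzConst (hK.abs_le_valueRadius hC hf w))
  have hval : |p w - f w| ≤ invNorm V (RKHS.kerFun H w 1) * (kappa K B *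
      (2 * (N + lam * (B / √rho)))) := by
    have h := abs_inner_le_invNorm hVp hVi (RKHS.kerFun H w 1) (p - f)
    rw [kerFun_one_inner, RKHS.coe_sub, Pi.sub_apply] at h
    refine h.trans (mul_le_mul_of_nonneg_left ?_ (invNorm_nonneg _ _))
    exact (hK.sqrt_inner_covOp_le hC hlam t z hp.1 hf hκ).trans
      (mul_le_mul_of_nonneg_left hpf hκ.le)
  have hsr : 0 < √rho := Real.sqrt_pos.2 hrho
  have hsq : √rho * √rho = lam * kappa K B := Real.mul_self_sqrt hrho.le
  calc |Real.sigmoid (p w) - Real.sigmoid (f w)|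
      ≤ lipschitzConst K B * |p w - f w| :=
        abs_sigmoid_sub_le (hK.abs_le_valueRadius hC hp.1 w) (hK.abs_le_valueRadius hC hf w)
    _ ≤ lipschitzConst K B * (invNorm V (RKHS.kerFun H w 1) * (kappa K B *
          (2 * (N + lam * (B / √rho))))) := mul_le_mul_of_nonneg_left hval hL
    _ = (2 * lipschitzConst K B * B * (lam * kappa K B / (√rho * √rho))
          + 2 * lipschitzConst K B * (kappa K B / √rho * N))
          * (√rho * invNorm V (RKHS.kerFun H w 1)) := by
        field_simp
        ring
    _ = (2 * lipschitzConst K B * B + 2 * lipschitzConst K B * (kappa K B / √rho * N))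
          * (√rho * invNorm V (RKHS.kerFun H w 1)) := by
        rw [hsq, div_self hrho.ne', mul_one]
    -- The argument gives 2LB; the constant 4LB in β leaves slack.
    _ ≤ _ := by
        refine mul_le_mul_of_nonneg_right ?_ (mul_nonneg hsr.le (invNorm_nonneg _ _))
        have := mul_nonneg hL hB
        linarith

lemma isBallProjection_self {B lam rho : ℝ} {t : ℕ} {z : ℕ → Z} {g : H} (hg : ‖g‖ ≤ B) :
    IsBallProjection B lam rho t z g g := by
  refine ⟨hg, fun θ _ => ?_⟩
  rw [sub_self, invNorm, inner_zero_left, Real.sqrt_zero]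
  exact invNorm_nonneg _ _

end ConfidenceBound

/-! ### Ville's inequality. -/

section Maximal

variable {Ω : Type*} {mΩ : MeasurableSpace Ω} {μ : Measure Ω}

/-- Ville's maximal inequality over a finite horizon. -/
lemma mul_measureReal_exists_le_add_setIntegral_le [IsFiniteMeasure μ] {ℱ : Filtration ℕ mΩ}
    {M : ℕ → Ω → ℝ} (hM : Supermartingale M ℱ μ) (c : ℝ) (n : ℕ) :
    c * μ.real {ω | ∃ t ≤ n, c ≤ M t ω} + ∫ ω in {ω | ∃ t ≤ n, c ≤ M t ω}ᶜ, M n ω ∂μ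
      ≤ ∫ ω, M 0 ω ∂μ := by
  have hmeas : ∀ n, MeasurableSet[ℱ n] {ω | ∃ t ≤ n, c ≤ M t ω} := fun n => by
    have : {ω | ∃ t ≤ n, c ≤ M t ω} = ⋃ t ∈ Finset.range (n + 1), {ω | c ≤ M t ω} := by
      ext ω; simp
    rw [this]
    refine Finset.measurableSet_biUnion _ fun t ht => ?_
    exact ℱ.mono (Finset.mem_range_succ_iff.1 ht) _
      ((hM.1 t).measurable measurableSet_Ici)
  have hge : ∀ (n : ℕ) (s : Set Ω), MeasurableSet s → (∀ ω ∈ s, c ≤ M n ω) →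
      c * μ.real s ≤ ∫ ω in s, M n ω ∂μ := fun n s hs h =>
    setIntegral_ge_of_const_le_real hs (measure_ne_top _ _) h (hM.2.2 n).integrableOn
  -- The integral over paths that have not crossed carries the induction: it does not increase from
  -- n to n + 1, and the newly crossed part contributes at least c times its measure.
  induction n with
  | zero =>
    have hs := ℱ.le 0 _ (hmeas 0)
    rw [← integral_add_compl hs (hM.2.2 0)]
    refine add_le_add_left (hge 0 _ hs ?_) _
    rintro ω ⟨t, ht, h⟩
    rwa [Nat.le_zero.1 ht] at h
  | succ n ih =>
    set A := {ω | ∃ t ≤ n, c ≤ M t ω}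
    set A' := {ω | ∃ t ≤ n + 1, c ≤ M t ω}
    have hA := ℱ.le n _ (hmeas n)
    have hA' := ℱ.le (n + 1) _ (hmeas (n + 1))
    have hsub : A ⊆ A' := fun ω ⟨t, ht, h⟩ => ⟨t, ht.trans n.le_succ, h⟩
    have h1 := hM.setIntegral_le n.le_succ (hmeas n).compl
    have h2 : ∫ ω in Aᶜ, M (n + 1) ω ∂μ
        = ∫ ω in A' \ A, M (n + 1) ω ∂μ + ∫ ω in A'ᶜ, M (n + 1) ω ∂μ := by
      rw [← setIntegral_union _ hA'.compl (hM.2.2 _).integrableOn (hM.2.2 _).integrableOn]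
      · congr 2
        ext ω
        have := @hsub ω
        simp only [Set.mem_compl_iff, Set.mem_union, Set.mem_sdiff]
        tauto
      · exact Set.disjoint_left.2 fun ω h h' => h' h.1
    have h3 := hge (n + 1) (A' \ A) (hA'.diff hA) (by
      rintro ω ⟨⟨t, ht, h⟩, hn⟩
      rcases ht.eq_or_lt with rfl | ht
      · exact h
      · exact absurd ⟨t, Nat.lt_succ_iff.1 ht, h⟩ hn)
    have h4 : μ.real A' = μ.real (A' \ A) + μ.real A := by
      rw [measureReal_sdiff hsub hA]; ring
    rw [h4]
    linarith

/-- Ville's inequality for nonnegative supermartingales. -/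
lemma measure_exists_le_supermartingale [IsFiniteMeasure μ] {ℱ : Filtration ℕ mΩ}
    {M : ℕ → Ω → ℝ} (hM : Supermartingale M ℱ μ) (hnn : ∀ t ω, 0 ≤ M t ω) {c : ℝ} (hc : 0 < c) :
    μ {ω | ∃ t, c ≤ M t ω} ≤ ENNReal.ofReal ((∫ ω, M 0 ω ∂μ) / c) := by
  have hU : {ω | ∃ t, c ≤ M t ω} = ⋃ n, {ω | ∃ t ≤ n, c ≤ M t ω} := by
    ext ω
    simp only [Set.mem_ofPred_eq, Set.mem_iUnion]
    exact ⟨fun ⟨t, h⟩ => ⟨t, t, le_rfl, h⟩, fun ⟨_, t, _, h⟩ => ⟨t, h⟩⟩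
  have hmono : Monotone fun n => {ω | ∃ t ≤ n, c ≤ M t ω} :=
    fun m n hmn ω ⟨t, ht, h⟩ => ⟨t, ht.trans hmn, h⟩
  rw [hU, hmono.measure_iUnion]
  refine iSup_le fun n => ?_
  have h := mul_measureReal_exists_le_add_setIntegral_le hM c n
  have h0 : 0 ≤ ∫ ω in {ω | ∃ t ≤ n, c ≤ M t ω}ᶜ, M n ω ∂μ := integral_nonneg fun ω => hnn n ω
  rw [← ofReal_measureReal]
  refine ENNReal.ofReal_le_ofReal ?_
  rw [le_div_iff₀ hc]
  linarith

end Maximal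

/-! ### The self-normalized supermartingale. -/

section SelfNormalized

variable {Z : Type*} {H : Type*} [NormedAddCommGroup H] [InnerProductSpace ℝ H]
  [CompleteSpace H] [RKHS ℝ H Z ℝ] {K : Z → Z → ℝ}

/-- The self-normalized process `exp(½ ‖∑ e_i φ(z_i)‖² in the V_t⁻¹-norm) / √det(I + ρ⁻¹ K_t)`. -/
noncomputable def mixtureProcess (H : Type*) [NormedAddCommGroup H] [InnerProductSpace ℝ H]
    [CompleteSpace H] [RKHS ℝ H Z ℝ] (K : Z → Z → ℝ) (rho : ℝ) (t : ℕ) (z : ℕ → Z)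
    (e : ℕ → ℝ) : ℝ :=
  Real.exp (invNorm (covOp rho t z) (noiseSum H t z e) ^ 2 / 2)
    / √(1 + rho⁻¹ • kernelMatrix K (fun i : Fin t => z i)).det

/-- The factor by which `mixtureProcess` grows in one step. -/
noncomputable def mixtureFactor (a q e : ℝ) : ℝ :=
  Real.exp ((2 * e * a + e ^ 2 * q - a ^ 2) / (2 * (1 + q))) / √(1 + q)

lemma mixtureFactor_nonneg (a q e : ℝ) : 0 ≤ mixtureFactor a q e :=
  div_nonneg (Real.exp_pos _).le (Real.sqrt_nonneg _)

/-- The numerator is e²(1+q) - (e-a)² ≤ 1+q, so the exponent is at most 1/2. The process is then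
bounded at each time, hence integrable. -/
lemma mixtureFactor_le {a q e : ℝ} (hq : 0 ≤ q) (he : |e| ≤ 1) :
    mixtureFactor a q e ≤ Real.exp (1 / 2) := by
  have h1 : 1 ≤ √(1 + q) := Real.one_le_sqrt.2 (by linarith)
  refine (div_le_self (Real.exp_pos _).le h1).trans (Real.exp_le_exp.2 ?_)
  rw [div_le_div_iff₀ (by positivity) (by norm_num)]
  have : e ^ 2 ≤ 1 := (sq_le_one_iff_abs_le_one e).2 he
  nlinarith [sq_nonneg (e - a)]

lemma mixtureFactor_bernoulli_le {p q : ℝ} (hp0 : 0 ≤ p) (hp1 : p ≤ 1) (hq : 0 ≤ q) (a : ℝ) :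
    p * mixtureFactor a q (1 - p) + (1 - p) * mixtureFactor a q (-p) ≤ 1 := by
  have h1 : 0 < √(1 + q) := Real.sqrt_pos.2 (by linarith)
  rw [mixtureFactor, mixtureFactor, mul_div_assoc', mul_div_assoc', ← add_div, div_le_one h1]
  exact bernoulli_mixture_le hp0 hp1 hq a

lemma measurable_mixtureFactor {Ω : Type*} {m : MeasurableSpace Ω} {a q e : Ω → ℝ}
    (ha : Measurable a) (hq : Measurable q) (he : Measurable e) :
    Measurable fun ω => mixtureFactor (a ω) (q ω) (e ω) := by
  unfold mixtureFactor
  fun_prop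

lemma mixtureProcess_nonneg (rho : ℝ) (t : ℕ) (z : ℕ → Z) (e : ℕ → ℝ) :
    0 ≤ mixtureProcess H K rho t z e :=
  div_nonneg (Real.exp_pos _).le (Real.sqrt_nonneg _)

lemma mixtureProcess_zero (rho : ℝ) (z : ℕ → Z) (e : ℕ → ℝ) :
    mixtureProcess H K rho 0 z e = 1 := by
  simp [mixtureProcess, noiseSum, invNorm]

lemma IsRKHSOf.mixtureProcess_succ (hK : IsRKHSOf H K) {rho : ℝ} (hrho : 0 < rho) (t : ℕ)
    (z : ℕ → Z) (e : ℕ → ℝ) :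
    mixtureProcess H K rho (t + 1) z e = mixtureProcess H K rho t z e
      * mixtureFactor (posteriorMean H rho t z e (z t))
          (posteriorKernel H rho t z (z t) (z t)) (e t) := by
  have hq := posteriorKernel_self_nonneg (H := H) hrho t z (z t)
  rw [mixtureProcess, mixtureProcess, mixtureFactor, div_mul_div_comm, ← Real.exp_add,
    ← Real.sqrt_mul (hK.det_one_add_pos hrho _).le, ← hK.det_one_add_succ hrho,
    invNorm_noiseSum_succ_sq hrho]
  congr 2
  have : 1 + posteriorKernel H rho t z (z t) (z t) ≠ 0 := by positivity
  field_simp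

lemma IsRKHSOf.mixtureProcess_le (hK : IsRKHSOf H K) {rho : ℝ} (hrho : 0 < rho) (t : ℕ)
    (z : ℕ → Z) {e : ℕ → ℝ} (he : ∀ i, |e i| ≤ 1) :
    mixtureProcess H K rho t z e ≤ Real.exp (1 / 2) ^ t := by
  induction t with
  | zero => rw [mixtureProcess_zero, pow_zero]
  | succ t ih =>
    rw [hK.mixtureProcess_succ hrho, pow_succ]
    exact mul_le_mul ih (mixtureFactor_le (posteriorKernel_self_nonneg hrho t z _) (he t))
      (mixtureFactor_nonneg _ _ _) (by positivity)

/-- Take logarithms: the realized ½ log det is dominated by the worst case γ_t. -/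
lemma IsRKHSOf.invNorm_noiseSum_le (hK : IsRKHSOf H K) {C : ℝ} (hC : ∀ z, K z z ≤ C)
    {rho : ℝ} (hrho : 0 < rho) {t : ℕ} {z : ℕ → Z} {e : ℕ → ℝ} {c : ℝ}
    (h : mixtureProcess H K rho t z e ≤ c) :
    invNorm (covOp rho t z) (noiseSum H t z e) ≤ √(2 * (infoGain K rho t + Real.log c)) := by
  have hdet := hK.det_one_add_pos hrho fun i : Fin t => z i
  refine Real.le_sqrt_of_sq_le ?_
  have h1 := Real.log_le_log (div_pos (Real.exp_pos _) (Real.sqrt_pos.2 hdet)) h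
  rw [Real.log_div (Real.exp_pos _).ne' (Real.sqrt_pos.2 hdet).ne', Real.log_exp,
    Real.log_sqrt hdet.le] at h1
  have h2 := hK.half_log_det_le_infoGain hC hrho fun i : Fin t => z i
  linarith

section Measurability

variable {Ω : Type*} {m : MeasurableSpace Ω} [MeasurableSpace Z]

lemma IsRKHSOf.measurable_posteriorKernel (hK : IsRKHSOf H K)
    (hm : Measurable (Function.uncurry K)) {rho : ℝ} (hrho : 0 < rho) {z : ℕ → Ω → Z} {t : ℕ}
    (hz : ∀ i < t, Measurable (z i)) {a b : Ω → Z} (ha : Measurable a) (hb : Measurable b) :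
    Measurable fun ω => posteriorKernel H rho t (fun i => z i ω) (a ω) (b ω) := by
  induction t generalizing a b with
  | zero =>
    have : (fun ω => posteriorKernel H rho 0 (fun i => z i ω) (a ω) (b ω))
        = fun ω => rho⁻¹ * K (a ω) (b ω) := by
      ext ω
      have h0 : covOp rho 0 (fun i => z i ω) (rho⁻¹ • (RKHS.kerFun H (b ω) 1 : H))
          = RKHS.kerFun H (b ω) 1 := by
        rw [covOp_apply, Finset.sum_range_zero, zero_add, smul_smul, mul_inv_cancel₀ hrho.ne',
          one_smul]
      rw [posteriorKernel, eq_inverse_covOp hrho h0, RKHS.coe_smul, Pi.smul_apply,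
        hK.kerFun_apply, smul_eq_mul]
    rw [this]
    exact (hm.comp (ha.prodMk hb)).const_mul _
  | succ t ih =>
    have ih' := fun {a b : Ω → Z} (ha : Measurable a) (hb : Measurable b) =>
      ih (fun i hi => hz i (hi.trans t.lt_succ_self)) ha hb
    have hzt := hz t t.lt_succ_self
    simp_rw [posteriorKernel_succ hrho]
    exact (ih' ha hb).sub (((ih' hzt hb).div ((ih' hzt hzt).const_add 1)).mul (ih' ha hzt))

lemma IsRKHSOf.measurable_posteriorMean (hK : IsRKHSOf H K)
    (hm : Measurable (Function.uncurry K)) {rho : ℝ} (hrho : 0 < rho) {z : ℕ → Ω → Z}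
    {e : ℕ → Ω → ℝ} {t : ℕ} (hz : ∀ i < t, Measurable (z i)) (he : ∀ i < t, Measurable (e i))
    {a : Ω → Z} (ha : Measurable a) :
    Measurable fun ω => posteriorMean H rho t (fun i => z i ω) (fun i => e i ω) (a ω) := by
  induction t generalizing a with
  | zero => simp [posteriorMean, noiseSum]
  | succ t ih =>
    have hz' : ∀ i < t, Measurable (z i) := fun i hi => hz i (hi.trans t.lt_succ_self)
    have ih' := fun {a : Ω → Z} (ha : Measurable a) =>
      ih hz' (fun i hi => he i (hi.trans t.lt_succ_self)) ha
    have hzt := hz t t.lt_succ_self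
    have het := he t t.lt_succ_self
    have hk := fun {a : Ω → Z} (ha : Measurable a) =>
      hK.measurable_posteriorKernel hm hrho hz' ha hzt
    simp_rw [posteriorMean_succ hrho]
    exact ((ih' ha).add (het.mul (hk ha))).sub
      ((((ih' hzt).add (het.mul (hk hzt))).div ((hk hzt).const_add 1)).mul (hk ha))

lemma IsRKHSOf.measurable_mixtureProcess (hK : IsRKHSOf H K)
    (hm : Measurable (Function.uncurry K)) {rho : ℝ} (hrho : 0 < rho) {z : ℕ → Ω → Z}
    {e : ℕ → Ω → ℝ} {t : ℕ} (hz : ∀ i < t, Measurable (z i)) (he : ∀ i < t, Measurable (e i)) :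
    Measurable fun ω => mixtureProcess H K rho t (fun i => z i ω) (fun i => e i ω) := by
  induction t with
  | zero => simp only [mixtureProcess_zero]; exact measurable_const
  | succ t ih =>
    have hz' : ∀ i < t, Measurable (z i) := fun i hi => hz i (hi.trans t.lt_succ_self)
    have he' : ∀ i < t, Measurable (e i) := fun i hi => he i (hi.trans t.lt_succ_self)
    have hzt := hz t t.lt_succ_self
    simp_rw [hK.mixtureProcess_succ hrho]
    exact (ih hz' he').mul (measurable_mixtureFactor
      (hK.measurable_posteriorMean hm hrho hz' he' hzt)
      (hK.measurable_posteriorKernel hm hrho hz' hzt hzt) (he t t.lt_succ_self))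

end Measurability

variable [MeasurableSpace Z] {Ω : Type*} {mΩ : MeasurableSpace Ω} {μ : Measure Ω}

lemma IsRKHSOf.supermartingale_mixtureProcess [IsProbabilityMeasure μ] (hK : IsRKHSOf H K)
    (hm : Measurable (Function.uncurry K)) {rho : ℝ} (hrho : 0 < rho) {ℱ : Filtration ℕ mΩ}
    {z : ℕ → Ω → Z} {y p : ℕ → Ω → ℝ} (hz : ∀ i, Measurable[ℱ i] (z i))
    (hy : ∀ i, Measurable[ℱ (i + 1)] (y i)) (hy01 : ∀ i ω, y i ω = 0 ∨ y i ω = 1)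
    (hp : ∀ i, Measurable[ℱ i] (p i)) (hp0 : ∀ i ω, 0 ≤ p i ω) (hp1 : ∀ i ω, p i ω ≤ 1)
    (hpref : ∀ i, μ[y i | ℱ i] =ᵐ[μ] p i) :
    Supermartingale (fun t ω =>
      mixtureProcess H K rho t (fun i => z i ω) (fun i => y i ω - p i ω)) ℱ μ := by
  set M : ℕ → Ω → ℝ := fun t ω =>
    mixtureProcess H K rho t (fun i => z i ω) (fun i => y i ω - p i ω) with hMdef
  have hz' : ∀ t, ∀ i ≤ t, Measurable[ℱ t] (z i) := fun t i hi => (hz i).mono (ℱ.mono hi) le_rfl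
  have he' : ∀ t, ∀ i < t, Measurable[ℱ t] fun ω => y i ω - p i ω := fun t i hi =>
    ((hy i).mono (ℱ.mono hi) le_rfl).sub ((hp i).mono (ℱ.mono hi.le) le_rfl)
  have hMm : ∀ t, Measurable[ℱ t] (M t) := fun t =>
    hK.measurable_mixtureProcess hm hrho (fun i hi => hz' t i hi.le) (he' t)
  have hM0 : ∀ t ω, 0 ≤ M t ω := fun t ω => mixtureProcess_nonneg _ _ _ _
  have hMle : ∀ t ω, M t ω ≤ Real.exp (1 / 2) ^ t := fun t ω =>
    hK.mixtureProcess_le hrho t _ fun i => by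
      have h0 := hp0 i ω
      have h1 := hp1 i ω
      rw [abs_le]
      rcases hy01 i ω with h | h <;> rw [h] <;> constructor <;> linarith
  have hbdd : ∀ (g : Ω → ℝ) (c : ℝ), Measurable g → (∀ ω, 0 ≤ g ω) → (∀ ω, g ω ≤ c) →
      Integrable g μ := fun g c hg h0 hc =>
    Integrable.of_bound hg.aestronglyMeasurable c (Filter.Eventually.of_forall fun ω => by
      rw [Real.norm_of_nonneg (h0 ω)]; exact hc ω)
  have hMi : ∀ t, Integrable (M t) μ := fun t =>
    hbdd _ _ ((hMm t).mono (ℱ.le t) le_rfl) (hM0 t) (hMle t)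
  refine supermartingale_nat (fun t => (hMm t).stronglyMeasurable) hMi fun t => ?_
  set a : Ω → ℝ := fun ω =>
    posteriorMean H rho t (fun i => z i ω) (fun i => y i ω - p i ω) (z t ω)
  set q : Ω → ℝ := fun ω => posteriorKernel H rho t (fun i => z i ω) (z t ω) (z t ω)
  have ha : Measurable[ℱ t] a :=
    hK.measurable_posteriorMean hm hrho (fun i hi => hz' t i hi.le) (he' t) (hz t)
  have hq : Measurable[ℱ t] q :=
    hK.measurable_posteriorKernel hm hrho (fun i hi => hz' t i hi.le) (hz t) (hz t)
  have hq0 : ∀ ω, 0 ≤ q ω := fun ω => posteriorKernel_self_nonneg hrho t _ _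
  set F₁ : Ω → ℝ := fun ω => M t ω * mixtureFactor (a ω) (q ω) (1 - p t ω) with hF₁
  set F₀ : Ω → ℝ := fun ω => M t ω * mixtureFactor (a ω) (q ω) (-p t ω) with hF₀
  have hF₁m : Measurable[ℱ t] F₁ :=
    (hMm t).mul (measurable_mixtureFactor ha hq ((hp t).const_sub 1))
  have hF₀m : Measurable[ℱ t] F₀ := (hMm t).mul (measurable_mixtureFactor ha hq (hp t).neg)
  have hF₁i : Integrable F₁ μ := hbdd _ (Real.exp (1 / 2) ^ t * Real.exp (1 / 2))
    (hF₁m.mono (ℱ.le t) le_rfl) (fun ω => mul_nonneg (hM0 t ω) (mixtureFactor_nonneg _ _ _))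
    fun ω => mul_le_mul (hMle t ω) (mixtureFactor_le (hq0 ω) (by
      rw [abs_le]; constructor <;> linarith [hp0 t ω, hp1 t ω])) (mixtureFactor_nonneg _ _ _)
      (by positivity)
  have hF₀i : Integrable F₀ μ := hbdd _ (Real.exp (1 / 2) ^ t * Real.exp (1 / 2))
    (hF₀m.mono (ℱ.le t) le_rfl) (fun ω => mul_nonneg (hM0 t ω) (mixtureFactor_nonneg _ _ _))
    fun ω => mul_le_mul (hMle t ω) (mixtureFactor_le (hq0 ω) (by
      rw [abs_le]; constructor <;> linarith [hp0 t ω, hp1 t ω])) (mixtureFactor_nonneg _ _ _)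
      (by positivity)
  have hyΩ : Measurable (y t) := (hy t).mono (ℱ.le _) le_rfl
  have hyi : Integrable (y t) μ := hbdd _ 1 hyΩ
    (fun ω => by rcases hy01 t ω with h | h <;> rw [h] <;> norm_num)
    (fun ω => by rcases hy01 t ω with h | h <;> simp [h])
  -- A binary label makes the next value affine in y_t, with coefficients known at time t since ℱ t
  -- contains the pair of that round. Only the conditional mean of y_t is then needed.
  have hsucc : M (t + 1) = (F₁ - F₀) * y t + F₀ := by
    ext ω
    have h := hK.mixtureProcess_succ hrho t (fun i => z i ω) (fun i => y i ω - p i ω)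
    simp only [Pi.add_apply, Pi.mul_apply, Pi.sub_apply, hF₁, hF₀, hMdef]
    rw [h]
    rcases hy01 t ω with h | h <;> simp [h, a, q]
  have hprod : Integrable ((F₁ - F₀) * y t) μ :=
    (hF₁i.sub hF₀i).mul_bdd (c := 1) hyΩ.aestronglyMeasurable
      (Filter.Eventually.of_forall fun ω => by rcases hy01 t ω with h | h <;> simp [h])
  rw [hsucc]
  have h1 := condExp_add hprod hF₀i (ℱ t)
  have h2 := condExp_mul_of_stronglyMeasurable_left
    (hF₁m.sub hF₀m).stronglyMeasurable hprod hyi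
  have h3 := condExp_of_stronglyMeasurable (ℱ.le t) hF₀m.stronglyMeasurable hF₀i
  filter_upwards [h1, h2, hpref t] with ω h1 h2 h4
  rw [h1, Pi.add_apply, h2, h3, Pi.mul_apply, h4, Pi.sub_apply]
  have h5 := mul_le_mul_of_nonneg_left
    (mixtureFactor_bernoulli_le (hp0 t ω) (hp1 t ω) (hq0 ω) (a ω)) (hM0 t ω)
  simp only [hF₁, hF₀]
  linarith

end SelfNormalized

/-! ### The dueling kernel and the final assembly. -/

lemma measurable_uncurry_duelingKernel {X : Type*} [MeasurableSpace X] {k : X → X → ℝ}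
    (hk : Measurable (Function.uncurry k)) :
    Measurable (Function.uncurry (duelingKernel k)) := by
  have h : ∀ {a b : (X × X) × (X × X) → X}, Measurable a → Measurable b →
      Measurable fun v => k (a v) (b v) := fun ha hb => hk.comp (ha.prodMk hb)
  have h1 : Measurable fun v : (X × X) × (X × X) => v.1.1 := by fun_prop
  have h2 : Measurable fun v : (X × X) × (X × X) => v.1.2 := by fun_prop
  have h3 : Measurable fun v : (X × X) × (X × X) => v.2.1 := by fun_prop
  have h4 : Measurable fun v : (X × X) × (X × X) => v.2.2 := by fun_prop
  exact (((h h1 h3).add (h h2 h4)).sub (h h1 h4)).sub (h h2 h3)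

/-- The feature map behind the dueling kernel is (x, x') ↦ k(x, ·) - k(x', ·); pairing it with f
gives f(x) - f(x'). -/
lemma IsRKHSOf.inner_sub_kerFun_eq_duelingKernel {X H : Type*} [NormedAddCommGroup H]
    [InnerProductSpace ℝ H] [CompleteSpace H] [RKHS ℝ H X ℝ] {k : X → X → ℝ}
    (hH : IsRKHSOf H k) (z w : X × X) :
    inner ℝ ((RKHS.kerFun H z.1 1 : H) - RKHS.kerFun H z.2 1)
      (RKHS.kerFun H w.1 1 - RKHS.kerFun H w.2 1) = duelingKernel k z w := by
  simp only [inner_sub_left, inner_sub_right, hH.inner_kerFun, duelingKernel]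
  ring

lemma IsRKHSOf.duelingKernel_self_le {X H : Type*} [NormedAddCommGroup H]
    [InnerProductSpace ℝ H] [CompleteSpace H] [RKHS ℝ H X ℝ] {k : X → X → ℝ}
    (hH : IsRKHSOf H k) (hk : ∀ x, k x x ≤ 1) (z : X × X) : duelingKernel k z z ≤ 4 := by
  have hn : ∀ x, ‖(RKHS.kerFun H x 1 : H)‖ ≤ 1 := fun x => by
    rw [hH.norm_kerFun]; exact Real.sqrt_le_one.2 (hk x)
  rw [← hH.inner_sub_kerFun_eq_duelingKernel, real_inner_self_eq_norm_sq]
  have := (norm_sub_le (RKHS.kerFun H z.1 1 : H) (RKHS.kerFun H z.2 1)).trans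
    (add_le_add (hn _) (hn _))
  nlinarith [norm_nonneg ((RKHS.kerFun H z.1 1 : H) - RKHS.kerFun H z.2 1)]

end Dueling

theorem mainTheorem3
    {X : Type*} [MeasurableSpace X]
    -- the normalized kernel `k`, its RKHS `H`, and the RKHS `HD` of the dueling kernel
    (k : X → X → ℝ) (hk_meas : Measurable (Function.uncurry k)) (hk_le : ∀ x, k x x ≤ 1)
    {H : Type*} [NormedAddCommGroup H] [InnerProductSpace ℝ H] [CompleteSpace H]
    [RKHS ℝ H X ℝ] (hH : Dueling.IsRKHSOf H k)
    {HD : Type*} [NormedAddCommGroup HD] [InnerProductSpace ℝ HD] [CompleteSpace HD]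
    [RKHS ℝ HD (X × X) ℝ] (hHD : Dueling.IsRKHSOf HD (Dueling.duelingKernel k))
    -- the utility
    (f : H) (B : ℝ) (hf : ‖f‖ ≤ B)
    (lam : ℝ) (hlam : 0 < lam) (δ : ℝ) (hδ : 0 < δ) (hδ1 : δ < 1)
    -- the preference feedback: `ℱ i` holds the first `i` rounds and the actions of the next one
    {Ω : Type*} {mΩ : MeasurableSpace Ω} (μ : Measure Ω) [IsProbabilityMeasure μ]
    (ℱ : Filtration ℕ mΩ) (x x' : ℕ → Ω → X) (y : ℕ → Ω → ℝ)
    (hx : ∀ i, Measurable[ℱ i] (x i)) (hx' : ∀ i, Measurable[ℱ i] (x' i))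
    (hy : ∀ i, Measurable[ℱ (i + 1)] (y i))
    (hy01 : ∀ i ω, y i ω = 0 ∨ y i ω = 1)
    (hpref : ∀ i, μ[y i | ℱ i] =ᵐ[μ] fun ω => Real.sigmoid (f (x i ω) - f (x' i ω)))
    -- the minimizer of the logistic loss with the dueling kernel, after `t` rounds
    (h : ℕ → Ω → HD)
    (hmin : ∀ t ω, IsMinOn
      (Dueling.logisticLoss (H := HD) lam t (fun i => (x i ω, x' i ω)) (fun i => y i ω))
      Set.univ (h t ω)) :
    ∃ A : Set Ω, MeasurableSet A ∧ ENNReal.ofReal (1 - δ) ≤ μ A ∧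
      ∀ ω ∈ A, ∀ t : ℕ, 1 ≤ t →
        (‖h t ω‖ ≤ B → ∀ u u' : X,
          |Real.sigmoid (h t ω (u, u')) - Real.sigmoid (f u - f u')| ≤
            Dueling.beta (Dueling.duelingKernel k) B lam δ t *
              Dueling.sigma (Dueling.duelingKernel k)
                (lam * Dueling.kappa (Dueling.duelingKernel k) B)
                (fun i : Fin t => (x i ω, x' i ω)) (u, u')) ∧
        (∀ p : HD, Dueling.IsBallProjection B lam
            (lam * Dueling.kappa (Dueling.duelingKernel k) B) t
            (fun i => (x i ω, x' i ω)) (h t ω) p → ∀ u u' : X,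
          |Real.sigmoid (p (u, u')) - Real.sigmoid (f u - f u')| ≤
            Dueling.beta (Dueling.duelingKernel k) B lam δ t *
              Dueling.sigma (Dueling.duelingKernel k)
                (lam * Dueling.kappa (Dueling.duelingKernel k) B)
                (fun i : Fin t => (x i ω, x' i ω)) (u, u')) := by
  obtain ⟨fD, hfD, hfD_apply⟩ := hHD.exists_eq_inner
    (fun z : X × X => (RKHS.kerFun H z.1 1 : H) - RKHS.kerFun H z.2 1)
    hH.inner_sub_kerFun_eq_duelingKernel f
  have hfD_eq : ∀ u u', fD (u, u') = f u - f u' := fun u u' => by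
    rw [hfD_apply, inner_sub_right, Dueling.inner_kerFun_one, Dueling.inner_kerFun_one]
  have hfB : ‖fD‖ ≤ B := hfD.trans hf
  have hC := hH.duelingKernel_self_le hk_le
  have hm := Dueling.measurable_uncurry_duelingKernel hk_meas
  have hκ : 0 < Dueling.kappa (Dueling.duelingKernel k) B :=
    Dueling.kappa_pos (mul_nonneg ((norm_nonneg f).trans hf)
      (Real.iSup_nonneg fun _ => Real.sqrt_nonneg _))
  have hrho := mul_pos hlam hκ
  set rho := lam * Dueling.kappa (Dueling.duelingKernel k) B
  have hz : ∀ i, Measurable[ℱ i] fun ω => (x i ω, x' i ω) := fun i => (hx i).prodMk (hx' i)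
  have hfm : Measurable (fD : X × X → ℝ) :=
    hHD.measurable_coe (fun w => hm.comp (measurable_id.prodMk measurable_const)) fD
  have hM := hHD.supermartingale_mixtureProcess (μ := μ) (y := y)
    (p := fun i ω => Real.sigmoid (fD (x i ω, x' i ω))) hm hrho hz hy hy01
    (fun i => continuous_sigmoid.measurable.comp (hfm.comp (hz i)))
    (fun i ω => Real.sigmoid_nonneg _) (fun i ω => Real.sigmoid_le_one _)
    (fun i => by simpa only [hfD_eq] using hpref i)
  have hδinv : 0 < 1 / δ := one_div_pos.2 hδ
  have hville := Dueling.measure_exists_le_supermartingale hM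
    (fun t ω => Dueling.mixtureProcess_nonneg _ _ _ _) hδinv
  -- The process starts at 1, so crossing level 1/δ has probability at most δ.
  simp only [Dueling.mixtureProcess_zero, integral_const, probReal_univ, one_smul,
    one_div_one_div] at hville
  set bad := {ω | ∃ t, 1 / δ ≤ Dueling.mixtureProcess HD (Dueling.duelingKernel k) rho t
    (fun i => (x i ω, x' i ω)) fun i => y i ω - Real.sigmoid (fD (x i ω, x' i ω))}
  have hbad : MeasurableSet bad := by
    have : bad = ⋃ t, {ω | 1 / δ ≤ Dueling.mixtureProcess HD (Dueling.duelingKernel k) rho t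
        (fun i => (x i ω, x' i ω)) fun i => y i ω - Real.sigmoid (fD (x i ω, x' i ω))} := by
      ext ω; simp [bad]
    rw [this]
    exact MeasurableSet.iUnion fun t =>
      ((hM.1 t).measurable.mono (ℱ.le t) le_rfl) measurableSet_Ici
  refine ⟨badᶜ, hbad.compl, ?_, fun ω hω t _ => ?_⟩
  · rw [prob_compl_eq_one_sub hbad, ENNReal.ofReal_sub _ hδ.le, ENNReal.ofReal_one]
    exact tsub_le_tsub_left hville 1
  · have hlt : Dueling.mixtureProcess HD (Dueling.duelingKernel k) rho t
        (fun i => (x i ω, x' i ω)) (fun i => y i ω - Real.sigmoid (fD (x i ω, x' i ω)))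
          ≤ 1 / δ := le_of_not_ge fun h => hω ⟨t, h⟩
    have hnoise := hHD.invNorm_noiseSum_le hC hrho hlt
    have hproj : ∀ p : HD, Dueling.IsBallProjection B lam rho t
        (fun i => (x i ω, x' i ω)) (h t ω) p → ∀ u u' : X,
        |Real.sigmoid (p (u, u')) - Real.sigmoid (f u - f u')| ≤
          Dueling.beta (Dueling.duelingKernel k) B lam δ t *
            Dueling.sigma (Dueling.duelingKernel k) rho
              (fun i : Fin t => (x i ω, x' i ω)) (u, u') := fun p hp u u' => by
      rw [← hfD_eq]
      exact hHD.abs_sigmoid_sub_le_of_noise hC hlam hfB (hmin t ω) hp hnoise (u, u')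
    exact ⟨fun hB => hproj _ (Dueling.isBallProjection_self hB), hproj⟩
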